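/- **Setting.** Let $X_{1,n},\dots,X_{n,n}$ ($n\ge 1$) be fixed predictors in a space $\mathcal X$. A tree fit is observed: its leaves $l_1,\dots,l_m$ partition $\mathcal X$, and the path to the leaf of interest $l_1$ consists of regions $p_1=\mathcal X,p_2,\dots,p_d$ and $p_{d+1}=l_1$. At $p_h$ there are $k_h\ge1$ candidate binary splits $s_h^1,\dots,s_h^{k_h}$; the split $s_h^k$ divides $p_h$ into $p_h^k$ and $p_h\setminus p_h^k$, and the observed split is $s_h^1$, with $p_h^1=p_{h+1}$. For $R\subseteq\mathcal X$ let $n_R=|\{i:X_{i,n}\in R\}|$, $n_1=n_{l_1}$, $\hat\pi_R=n_R^{-1}\sum_i Y_{i,n}\mathbf 1[X_{i,n}\in R]$. The outcomes $Y_{1,n},\dots,Y_{n,n}$ are independent, $Y_{i,n}\sim\mathrm{Bernoulli}(\theta_{i,n})$ with $\theta_{i,n}=\sum_{j=1}^m\pi_{j,n}\mathbf 1[X_{i,n}\in l_j]$, $\pi_{j,n}\in(0,1)$. Given an impurity function $\mathcal I$ and constants $\epsilon_1,\dots,\epsilon_d$, the information gain of a split of $P$ into $C$ and $P\setminus C$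 is $\mathcal I(\hat\pi_P)-\frac{n_C}{n_P}\mathcal I(\hat\pi_C)-\frac{n_{P\setminus C}}{n_P}\mathcal I(\hat\pi_{P\setminus C})$. Given $Y$, the random splits $S_1,\dots,S_d$ drawn at $p_1,\dots,p_d$ are independent, and $S_h=s_h^k$ with probability proportional to $\exp(\epsilon_h G_h^k)$, where $G_h^k$ is the gain of $s_h^k$ (exponential mechanism). Let $\{\mathbf S_1=\mathbf s_1\}=\bigcap_{h}\{S_h=s_h^1\}$. The key statistics are $\hat T_{n,1}=\sqrt{n_1}\,\hat\pi_{l_1}$ and the vector $\hat T_{n,-1}$ with entries $\hat\pi_{-1}(p_h)$ and $\hat\pi_{-1}(p_h^k)$, $2\le k\le k_h$, $1\le h\le d$, where $\hat\pi_{-1}(R)=\sqrt{n_R}\,\hat\pi_R-\frac{n_{R\cap l_1}}{\sqrt{n_1n_R}}\sqrt{n_1}\,\hat\pi_{l_1}$; let $\Sigma_n$ be the covariance matrix of $\hat T_n=(\hat T_{n,1},\hat T_{n,-1})$. Since $\hat\pi_{-1}(l_1)=0$, the relation $\hat\pi_R=\frac{n_{R\cap l_1}}{n_R\sqrt{n_1}}\hat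 T_{n,1}+\frac{1}{\sqrt{n_R}}\hat\pi_{-1}(R)$ expresses $\hat\pi_{p_h}$ and $\hat\pi_{p_h^k}$, and hence also $\hat\pi_{p_h\setminus p_h^k}=(n_{p_h}\hat\pi_{p_h}-n_{p_h^k}\hat\pi_{p_h^k})/(n_{p_h}-n_{p_h^k})$, as linear functions of $\hat T_n$. Let $\tilde D_n$ be the set of points $(u,v)$ at which all these linear functions take values in $(0,1)$. On $\tilde D_n$ let $\mathcal G_h^k(u,v)$ be the gain $G_h^k$ rewritten, through these linear functions, as a function of the value $(u,v)$ of $(\hat T_{n,1},\hat T_{n,-1})$, and let $\lambda_h(u,v)=e^{\epsilon_h\mathcal G_h^1(u,v)}/\sum_{k}e^{\epsilon_h\mathcal G_h^k(u,v)}$; put $\lambda_h=0$ outside $\tilde D_n$. With $\phi(\cdot;\mu,\sigma^2)$ the normal density, $\Pi_{n,1}=\sqrt{n_1}\,\pi_{1,n}$ and $\sigma_{n,1}^2=\pi_{1,n}(1-\pi_{1,n})$, put $$\mathrm{Pivot}(\hat T_{n,1};\Pi_{n,1},\sigma^2)=\frac{\int_{-\infty}^{\hat T_{n,1}}\phi(u;\Pi_{n,1},\sigma^2)\prod_{h=1}^d\lambda_h(u,\hat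 T_{n,-1})\,du}{\int_{-\infty}^{\infty}\phi(u;\Pi_{n,1},\sigma^2)\prod_{h=1}^d\lambda_h(u,\hat T_{n,-1})\,du}.$$ **Assumptions.** (1) $\lim_{n\to\infty} n/n_R$ exists and is finite for $R=l_1$ and for all $R=p_h^k$ and $R=p_h\setminus p_h^k$. (2) $\liminf_n\pi_{j,n}>0$ and $\limsup_n\pi_{j,n}<1$ for every $j$. (3) There are $b,B>0$ such that, for all sufficiently large $n$, all eigenvalues of $\Sigma_n$ lie strictly between $1/b^2$ and $B^2$. (4) $\mathcal I$ is bounded and three times differentiable on $(0,1)$, with bounded derivatives of orders one to three. (Its values at $0$ and $1$ are arbitrary real numbers.) **Theorem.** Under (1)–(4), let $\hat\sigma_{n,1}^2$ be real random variables with $\hat\sigma_{n,1}^2-\sigma_{n,1}^2\to0$ in probability, unconditionally. Then: (i) for every $\delta>0$, $\displaystyle\lim_{n\to\infty}\mathbb P\big(|\hat\sigma_{n,1}^2-\sigma_{n,1}^2|>\delta\mid\mathbf S_1=\mathbf s_1\big)=0$; (ii) conditionally on $\{\mathbf S_1=\mathbf s_1\}$, $\mathrm{Pivot}(\hat T_{n,1};\Pi_{n,1},\hat\sigma_{n,1}^2)$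 converges in distribution to $\mathrm{Uniform}[0,1]$. (Where $\hat\sigma_{n,1}^2\le0$ or the denominator vanishes, an event of vanishing conditional probability, the pivot may be given any fixed convention.) -/

import Mathlib

open MeasureTheory ProbabilityTheory Filter Topology
open scoped ENNReal

namespace TreeInference

noncomputable section

/-! ### Sample proportions, information gain, exponential mechanism -/

section Sample

variable {𝒳 : Type*} {n : ℕ}

open Classical in
/-- `n_R`: the number of observations whose predictor lies in the region `R`. -/
def count (x : Fin n → 𝒳) (R : Set 𝒳) : ℕ := (Finset.univ.filter fun i => x i ∈ R).card

open Classical in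
/-- The sample proportion of the region `R`: the average of the binary outcomes over `R`. -/
def prop (x : Fin n → 𝒳) (y : Fin n → Bool) (R : Set 𝒳) : ℝ :=
  (1 / (count x R : ℝ)) * ∑ i, ((y i).toNat : ℝ) * (if x i ∈ R then 1 else 0)

/-- Information gain `G_P(s; y)` of the split of the region `P` into `C` and `P \ C`, for the
impurity measure `I(R; y) = I (prop x y R)`. -/
def gain (I : ℝ → ℝ) (x : Fin n → 𝒳) (y : Fin n → Bool) (P C : Set 𝒳) : ℝ :=
  I (prop x y P) -
    ((count x C : ℝ) / count x P * I (prop x y C) +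
      (count x (P \ C) : ℝ) / count x P * I (prop x y (P \ C)))

/-- Exponential mechanism: the probability of selecting the `j`-th of the candidate splits
`P = C k ∪ (P \ C k)` of the region `P`, given the outcomes `y`. -/
def splitProb {K : ℕ} (I : ℝ → ℝ) (ε : ℝ) (x : Fin n → 𝒳) (y : Fin n → Bool) (P : Set 𝒳)
    (C : Fin K → Set 𝒳) (j : Fin K) : ℝ :=
  Real.exp (ε * gain I x y P (C j)) / ∑ k, Real.exp (ε * gain I x y P (C k))

/-- The orthogonalized proportion `√n_R π̂_R - n_{R ∩ l} / √(n_l n_R) * (√n_l π̂_l)`. -/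
def orthProp (x : Fin n → 𝒳) (y : Fin n → Bool) (l R : Set 𝒳) : ℝ :=
  √(count x R) * prop x y R -
    (count x (R ∩ l) : ℝ) / √((count x l : ℝ) * count x R) * (√(count x l) * prop x y l)

/-- The scaling vector of the split of `P` into `C` and `P \ C` (entries numbered from 0). -/
def scaling (x : Fin n → 𝒳) (l P C : Set 𝒳) : Fin 8 → ℝ :=
  ![√(count x l) / count x P,
    1 / √(count x P),
    (count x (C ∩ l) : ℝ) / (count x C * √(count x l)),
    1 / √(count x C),
    ((count x (P ∩ l) : ℝ) - count x (C ∩ l)) / (((count x P : ℝ) - count x C) * √(count x l)),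
    √(count x P) / ((count x P : ℝ) - count x C),
    -(√(count x C) / ((count x P : ℝ) - count x C)),
    (count x C : ℝ) / count x P]

end Sample

/-- The set `D(η)` of points at which the three arguments of the information measure lie
in `(0, 1)`. -/
def scaledDomain (η : Fin 8 → ℝ) : Set (ℝ × ℝ × ℝ) :=
  {w | η 0 * w.1 + η 1 * w.2.1 ∈ Set.Ioo (0 : ℝ) 1 ∧
    η 2 * w.1 + η 3 * w.2.2 ∈ Set.Ioo (0 : ℝ) 1 ∧
    η 4 * w.1 + η 5 * w.2.1 + η 6 * w.2.2 ∈ Set.Ioo (0 : ℝ) 1}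

/-- The map `g_η(x, y, z)`. -/
def scaledGain (I : ℝ → ℝ) (η : Fin 8 → ℝ) (w : ℝ × ℝ × ℝ) : ℝ :=
  I (η 0 * w.1 + η 1 * w.2.1) - η 7 * I (η 2 * w.1 + η 3 * w.2.2) -
    (1 - η 7) * I (η 4 * w.1 + η 5 * w.2.1 + η 6 * w.2.2)

/-! ### The observed tree fit -/

/-- An observed tree fit on the predictor space `𝒳`, seen from one of its leaves: the partition of
`𝒳` into leaves, the path of internal regions `p_1 = 𝒳, …, p_d` that leads to the leaf of interest
`leaf 0`, and the candidate splits of each region on that path. A candidate binary split of `p_h` is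
given by one of its two subregions, the other one being the complement in `p_h`. Candidate `0` is
the observed split, and its subregion is the next region on the path. -/
structure TreeFit (𝒳 : Type*) where
  /-- the number of leaves, minus one -/
  m : ℕ
  leaf : Fin (m + 1) → Set 𝒳
  leaf_disjoint : Pairwise fun i j => Disjoint (leaf i) (leaf j)
  leaf_cover : ⋃ j, leaf j = Set.univ
  /-- the number of splits on the path to the leaf of interest -/
  d : ℕ
  node : Fin (d + 1) → Set 𝒳
  node_root : node 0 = Set.univ
  node_last : node (Fin.last d) = leaf 0
  /-- the number of candidate splits at each region of the path, minus one -/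
  k : Fin d → ℕ
  cand : (h : Fin d) → Fin (k h + 1) → Set 𝒳
  cand_subset : ∀ h j, cand h j ⊆ node h.castSucc
  cand_zero : ∀ h, cand h 0 = node h.succ

namespace TreeFit

variable {𝒳 : Type*} (t : TreeFit 𝒳) {n : ℕ}

/-- Positions in the vectors `v = (v^h, v^{h,k})`: position `⟨h, 0⟩` belongs to the internal region
`p_h`, and `⟨h, j⟩` with `j ≠ 0` to the candidate region `cand h j`. -/
abbrev Idx : Type := Σ h : Fin t.d, Fin (t.k h + 1)

/-- The key statistics other than the first one. -/
def restStat (x : Fin n → 𝒳) (y : Fin n → Bool) (i : t.Idx) : ℝ :=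
  orthProp x y (t.leaf 0) (if i.2 = 0 then t.node i.1.castSucc else t.cand i.1 i.2)

/-- The first key statistic `√n_1 π̂_1`. -/
def mainStat (x : Fin n → 𝒳) (y : Fin n → Bool) : ℝ :=
  √(count x (t.leaf 0)) * prop x y (t.leaf 0)

/-- The whole vector of key statistics; `none` is the position of the first one. -/
def keyStat (x : Fin n → 𝒳) (y : Fin n → Bool) : Option t.Idx → ℝ
  | none => t.mainStat x y
  | some i => t.restStat x y i

/-- The entry of `v` that belongs to the subregion `cand h j`: it is `v^{h,j}` for `j ≠ 0`, and
`v^{h+1}` for the observed split, where `v^{d+1} = 0` since the orthogonalized proportion of the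
leaf of interest itself is `0`. -/
def childEntry (v : t.Idx → ℝ) (h : Fin t.d) (j : Fin (t.k h + 1)) : ℝ :=
  if j = 0 then
    if hlt : h.val + 1 < t.d then v ⟨⟨h.val + 1, hlt⟩, 0⟩ else 0
  else v ⟨h, j⟩

/-- The scaling vector of the `j`-th candidate split at `p_h`. -/
def eta (x : Fin n → 𝒳) (h : Fin t.d) (j : Fin (t.k h + 1)) : Fin 8 → ℝ :=
  scaling x (t.leaf 0) (t.node h.castSucc) (t.cand h j)

/-- The information gain of the `j`-th candidate split at `p_h` as a function of the values `(u, v)`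
of the key statistics. -/
def gainFn (I : ℝ → ℝ) (x : Fin n → 𝒳) (h : Fin t.d) (j : Fin (t.k h + 1)) (u : ℝ)
    (v : t.Idx → ℝ) : ℝ :=
  scaledGain I (t.eta x h j) (u, v ⟨h, 0⟩, t.childEntry v h j)

/-- The common domain of the gains. -/
def domain (x : Fin n → 𝒳) : Set (ℝ × (t.Idx → ℝ)) :=
  {w | ∀ (h : Fin t.d) (j : Fin (t.k h + 1)),
    (w.1, w.2 ⟨h, 0⟩, t.childEntry w.2 h j) ∈ scaledDomain (t.eta x h j)}

open Classical in
/-- The correction factor `λ_h(u, v)`, extended by `0` outside the domain. -/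
def lam (I : ℝ → ℝ) (ε : Fin t.d → ℝ) (x : Fin n → 𝒳) (h : Fin t.d) (u : ℝ)
    (v : t.Idx → ℝ) : ℝ :=
  if (u, v) ∈ t.domain x then
    Real.exp (ε h * t.gainFn I x h 0 u v) / ∑ j, Real.exp (ε h * t.gainFn I x h j u v)
  else 0

/-- The unnormalized density `φ(u; mean, σ2) ∏_h λ_h(u, v)`. -/
def pivotDensity (I : ℝ → ℝ) (ε : Fin t.d → ℝ) (x : Fin n → 𝒳) (v : t.Idx → ℝ)
    (mean σ2 u : ℝ) : ℝ :=
  gaussianPDFReal mean σ2.toNNReal u * ∏ h, t.lam I ε x h u v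

/-- The pivot, at the value `s` of the first and `v` of the other key statistics. -/
def pivot (I : ℝ → ℝ) (ε : Fin t.d → ℝ) (x : Fin n → 𝒳) (s : ℝ) (v : t.Idx → ℝ)
    (mean σ2 : ℝ) : ℝ :=
  (∫ u in Set.Iic s, t.pivotDensity I ε x v mean σ2 u) /
    ∫ u, t.pivotDensity I ε x v mean σ2 u

open Classical in
/-- The success probability `θ_i = ∑_j π_j 1[X_i ∈ l_j]`. -/
def theta (x : Fin n → 𝒳) (π : Fin (t.m + 1) → ℝ) (i : Fin n) : ℝ :=
  ∑ j, π j * (if x i ∈ t.leaf j then 1 else 0)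

/-- The model for the outcomes `Y` and for the random splits `S h` drawn at the regions of the path:
the outcomes are independent Bernoulli variables with means `theta`, and, given the outcomes, the
splits are independent and follow the exponential mechanism. -/
structure IsModel {Ω : Type*} [MeasurableSpace Ω] (P : Measure Ω) (I : ℝ → ℝ) (ε : Fin t.d → ℝ)
    (x : Fin n → 𝒳) (π : Fin (t.m + 1) → ℝ) (Y : Fin n → Ω → Bool)
    (S : (h : Fin t.d) → Ω → Fin (t.k h + 1)) : Prop where
  isProb : IsProbabilityMeasure P
  param_mem : ∀ j, π j ∈ Set.Ioo (0 : ℝ) 1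
  measurable_Y : ∀ i, Measurable (Y i)
  measurable_S : ∀ h, Measurable (S h)
  indep : iIndepFun Y P
  bernoulli : ∀ i, P.real {ω | Y i ω = true} = t.theta x π i
  mechanism : ∀ (y : Fin n → Bool) (s : (h : Fin t.d) → Fin (t.k h + 1)),
    P.real {ω | (∀ i, Y i ω = y i) ∧ ∀ h, S h ω = s h} =
      P.real {ω | ∀ i, Y i ω = y i} *
        ∏ h, splitProb I (ε h) x y (t.node h.castSucc) (t.cand h) (s h)

/-- The event that the splits drawn along the path are the observed ones. -/
def observed {Ω : Type*} (S : (h : Fin t.d) → Ω → Fin (t.k h + 1)) : Set Ω :=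
  {ω | ∀ h, S h ω = 0}

/-- The covariance matrix of the vector of key statistics. -/
def covMat {Ω : Type*} [MeasurableSpace Ω] (P : Measure Ω) (x : Fin n → 𝒳)
    (Y : Fin n → Ω → Bool) : Matrix (Option t.Idx) (Option t.Idx) ℝ :=
  Matrix.of fun i j =>
    cov[fun ω => t.keyStat x (fun l => Y l ω) i, fun ω => t.keyStat x (fun l => Y l ω) j; P]

/-! ### Assumptions -/

/-- The sample sizes of the leaf of interest and of all candidate subregions along the path grow
proportionally to `n`: `lim n / n_R < ∞`. -/
def ProportionalGrowth (X : (n : ℕ) → Fin n → 𝒳) : Prop :=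
  ∀ R : Set 𝒳, (R = t.leaf 0 ∨ ∃ h j, R = t.cand h j ∨ R = t.node h.castSucc \ t.cand h j) →
    ∃ c : ℝ≥0∞, c < ∞ ∧ Tendsto (fun n : ℕ => (n : ℝ≥0∞) / (count (X n) R : ℝ≥0∞)) atTop (𝓝 c)

/-- The leaf parameters are bounded away from `0` and `1`. -/
def ParamsBounded (π : ℕ → Fin (t.m + 1) → ℝ) : Prop :=
  ∀ j, 0 < liminf (fun n => π n j) atTop ∧ limsup (fun n => π n j) atTop < 1

/-- The eigenvalues of the covariance matrices of the key statistics are, for all sufficiently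
large `n`, bounded away from `0` and `∞`. -/
def CovNondegenerate {Ω : ℕ → Type*} [∀ n, MeasurableSpace (Ω n)] (P : ∀ n, Measure (Ω n))
    (X : (n : ℕ) → Fin n → 𝒳) (Y : ∀ n, Fin n → Ω n → Bool) : Prop :=
  ∃ b B : ℝ, 0 < b ∧ 0 < B ∧ ∀ᶠ n in atTop, ∀ μ : ℝ,
    Module.End.HasEigenvalue (Matrix.toLin' (t.covMat (P n) (X n) (Y n))) μ →
      1 / b ^ 2 < μ ∧ μ < B ^ 2

end TreeFit

/-- The information measure is bounded and three times differentiable on `(0, 1)`, with bounded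
derivatives of orders one to three. -/
def SmoothInformation (I : ℝ → ℝ) : Prop :=
  (∀ r < 3, DifferentiableOn ℝ (iteratedDeriv r I) (Set.Ioo 0 1)) ∧
    ∀ r ≤ 3, ∃ C : ℝ, ∀ x ∈ Set.Ioo (0 : ℝ) 1, |iteratedDeriv r I x| ≤ C

end

end TreeInference

/-!
Given the outcomes, the observed splits are drawn with a probability that is a continuous function
of the empirical proportions. These concentrate around their means, which stay in a compact subset
of `(0, 1)`, so the selection probability is asymptotically a constant bounded away from `0`.
Conditioning on the selection therefore changes neither a convergence in probability nor the weak
limit `N(0, 1)` of the standardized first key statistic `Z`.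

The weight `∏ λ_h` in the pivot is the selection probability at the proportions obtained by moving
the first key statistic to `u`. As `u` ranges over a window of fixed width around `√n₁ π₁`, this
moves the proportions by `O(1 / √n₁)` only, so the weight is nearly constant on the window and
cancels in the quotient. Outside the window the Gaussian has little mass. Hence the pivot differs
from `Φ(Z)` by a term that vanishes in probability, and `Φ` of a standard normal variable is
uniformly distributed.
-/

namespace TreeInference

open scoped NNReal BoundedContinuousFunction

noncomputable section

/-! ### Distribution functions -/

section DistributionFunction

variable {μ : Measure ℝ} [IsProbabilityMeasure μ]

lemma cdf_sub_cdf {x y : ℝ} (h : x ≤ y) : cdf μ y - cdf μ x = μ.real (Set.Ioc x y) := by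
  rw [cdf_eq_real, cdf_eq_real, ← measureReal_sdiff (Set.Iic_subset_Iic.2 h) measurableSet_Iic,
    Set.Iic_sdiff_Iic]

lemma lipschitzWith_cdf {K : ℝ≥0} (h : μ ≤ K • volume) : LipschitzWith K (cdf μ) := by
  have hle : ∀ x y, x ≤ y → cdf μ y ≤ cdf μ x + K * dist y x := fun x y hxy => by
    have hIoc : μ.real (Set.Ioc x y) ≤ K * (y - x) := by
      refine ENNReal.toReal_le_of_le_ofReal (by have := sub_nonneg.2 hxy; positivity)
        ((h _).trans_eq ?_)
      rw [Measure.smul_apply, Real.volume_Ioc, ENNReal.ofReal_mul K.coe_nonneg,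
        ENNReal.ofReal_coe_nnreal, ENNReal.smul_def, smul_eq_mul]
    rw [Real.dist_eq, abs_of_nonneg (sub_nonneg.2 hxy)]
    linarith [cdf_sub_cdf (μ := μ) hxy]
  refine LipschitzWith.of_le_add_mul K fun x y => ?_
  rcases le_total x y with hxy | hyx
  · exact (monotone_cdf μ hxy).trans (le_add_of_nonneg_right (by positivity))
  · exact hle y x hyx

lemma measureReal_setOf_cdf_le (h : Continuous (cdf μ)) {a : ℝ} (ha0 : 0 ≤ a) (ha1 : a < 1) :
    μ.real {x | cdf μ x ≤ a} = a := by
  rcases Set.eq_empty_or_nonempty {x | cdf μ x ≤ a} with hempty | hne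
  · have hgt : ∀ x, a < cdf μ x := fun x => not_le.1 (Set.eq_empty_iff_forall_notMem.1 hempty x)
    have ha : a ≤ 0 := ge_of_tendsto' (tendsto_cdf_atBot μ) fun x => (hgt x).le
    rw [hempty, measureReal_empty, le_antisymm ha ha0]
  · obtain ⟨y, hy⟩ := ((tendsto_cdf_atTop μ).eventually (lt_mem_nhds ha1)).exists
    have hbdd : BddAbove {x | cdf μ x ≤ a} :=
      ⟨y, fun x hx => ((monotone_cdf μ).reflect_lt (lt_of_le_of_lt hx hy)).le⟩
    set z := sSup {x | cdf μ x ≤ a}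
    have hz : cdf μ z ≤ a := (isClosed_le h continuous_const).csSup_mem hne hbdd
    have hz' : a ≤ cdf μ z := by
      refine ge_of_tendsto (h.continuousWithinAt (s := Set.Ioi z) (x := z)) ?_
      filter_upwards [self_mem_nhdsWithin] with x hx
      exact (not_le.1 fun hxa => (not_le.2 hx) (le_csSup hbdd hxa)).le
    have hIic : {x | cdf μ x ≤ a} = Set.Iic z :=
      Set.Subset.antisymm (fun x hx => le_csSup hbdd hx) fun x hx => (monotone_cdf μ hx).trans hz
    rw [hIic, ← cdf_eq_real, le_antisymm hz hz']

lemma map_cdf_eq_restrict_volume (h : Continuous (cdf μ)) :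
    μ.map (cdf μ) = (volume : Measure ℝ).restrict (Set.Icc 0 1) := by
  have := Measure.isProbabilityMeasure_map (μ := μ) h.measurable.aemeasurable
  refine Measure.ext_of_Iic _ _ fun a => ?_
  rw [Measure.map_apply h.measurable measurableSet_Iic, Measure.restrict_apply measurableSet_Iic]
  change μ {x | cdf μ x ≤ a} = _
  rcases lt_or_ge a 0 with ha0 | ha0
  · have hl : {x | cdf μ x ≤ a} = ∅ :=
      Set.eq_empty_of_forall_notMem fun x hx => (ha0.trans_le (cdf_nonneg μ x)).not_ge hx
    have hr : Set.Iic a ∩ Set.Icc 0 1 = ∅ :=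
      Set.eq_empty_of_forall_notMem fun x hx => (ha0.trans_le hx.2.1).not_ge hx.1
    rw [hl, hr, measure_empty, measure_empty]
  rcases lt_or_ge a 1 with ha1 | ha1
  · have hr : Set.Iic a ∩ Set.Icc 0 1 = Set.Icc 0 a := by
      rw [← Set.Ici_inter_Iic, Set.inter_left_comm, Set.Iic_inter_Iic, min_eq_left ha1.le,
        Set.Ici_inter_Iic]
    rw [hr, Real.volume_Icc, sub_zero, ← ofReal_measureReal, measureReal_setOf_cdf_le h ha0 ha1]
  · have hl : {x | cdf μ x ≤ a} = Set.univ :=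
      Set.eq_univ_of_forall fun x => (cdf_le_one μ x).trans ha1
    have hr : Set.Iic a ∩ Set.Icc 0 1 = Set.Icc 0 1 :=
      Set.inter_eq_right.2 fun x hx => hx.2.trans ha1
    rw [hl, hr, measure_univ, Real.volume_Icc, sub_zero, ENNReal.ofReal_one]

lemma identDistrib_cdf_coe_unitInterval (h : Continuous (cdf μ)) :
    IdentDistrib (cdf μ) ((↑) : unitInterval → ℝ) μ volume where
  aemeasurable_fst := h.measurable.aemeasurable
  aemeasurable_snd := measurable_subtype_coe.aemeasurable
  map_eq := by rw [map_cdf_eq_restrict_volume h, unitInterval.measurePreserving_coe.map_eq]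

end DistributionFunction

lemma gaussianPDFReal_zero_one_le_one (x : ℝ) : gaussianPDFReal 0 1 x ≤ 1 := by
  have hexp : Real.exp (-(x - 0) ^ 2 / (2 * ((1 : ℝ≥0) : ℝ))) ≤ 1 :=
    Real.exp_le_one_iff.2 (by simp only [NNReal.coe_one]; linarith [sq_nonneg (x - 0)])
  have hsqrt : (√(2 * Real.pi * ((1 : ℝ≥0) : ℝ)))⁻¹ ≤ 1 :=
    inv_le_one_of_one_le₀ (Real.one_le_sqrt.2 (by
      simp only [NNReal.coe_one]; linarith [Real.pi_gt_three]))
  exact mul_le_one₀ hsqrt (Real.exp_pos _).le hexp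

lemma lipschitzWith_cdf_gaussianReal_zero_one : LipschitzWith 1 (cdf (gaussianReal 0 1)) := by
  refine lipschitzWith_cdf ?_
  rw [one_smul, gaussianReal_of_var_ne_zero 0 one_ne_zero]
  exact (withDensity_mono (ae_of_all _ fun x =>
    ENNReal.ofReal_le_one.2 (gaussianPDFReal_zero_one_le_one x))).trans_eq withDensity_one

lemma cdf_gaussianReal (m : ℝ) {v : ℝ≥0} (hv : v ≠ 0) (s : ℝ) :
    cdf (gaussianReal m v) s = cdf (gaussianReal 0 1) ((s - m) / √v) := by
  have hv' : (0 : ℝ) < √v := Real.sqrt_pos.2 (by positivity)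
  have hmap : gaussianReal m v = ((gaussianReal 0 1).map (√v * ·)).map (· + m) := by
    rw [gaussianReal_map_const_mul, gaussianReal_map_add_const]
    congr 1
    · simp
    · ext; simp
  have hpre : (fun u => u + m) ∘ (fun u => √v * u) ⁻¹' Set.Iic s = Set.Iic ((s - m) / √v) := by
    ext u
    simp only [Set.mem_preimage, Function.comp_apply, Set.mem_Iic, le_div_iff₀ hv',
      le_sub_iff_add_le, mul_comm]
  rw [cdf_eq_real, cdf_eq_real, hmap, Measure.map_map (by fun_prop) (by fun_prop),
    map_measureReal_apply (by fun_prop) measurableSet_Iic, hpre]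

/-! ### Weights that are almost constant -/

section Weights

variable {α : Type*} [MeasurableSpace α] {μ : Measure α} [IsProbabilityMeasure μ]

lemma integral_le_add_mul_measureReal {f : α → ℝ} (hf : Integrable f μ) {A : Set α}
    (hA : NullMeasurableSet A μ) {a b : ℝ} (hfa : ∀ x ∉ A, f x ≤ a) (hfb : ∀ x ∈ A, f x ≤ a + b) :
    ∫ x, f x ∂μ ≤ a + b * μ.real A := by
  have hind : Integrable (A.indicator fun _ => b) μ := (integrable_const b).indicator₀ hA
  calc ∫ x, f x ∂μ ≤ ∫ x, (a + A.indicator (fun _ => b) x) ∂μ := by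
        refine integral_mono hf ((integrable_const a).add hind) fun x => ?_
        by_cases hx : x ∈ A
        · simpa only [Set.indicator_of_mem hx] using hfb x hx
        · simpa only [Set.indicator_of_notMem hx, add_zero] using hfa x hx
    _ = a + b * μ.real A := by
        rw [integral_add (integrable_const a) hind, integral_indicator₀ hA]
        simp [mul_comm]

variable {E : Type*} [NormedAddCommGroup E] [NormedSpace ℝ E]

lemma norm_integral_smul_sub_smul_integral_le {Λ : α → ℝ} {g : α → E} {C : ℝ}
    (hΛ : Integrable Λ μ) (hg : AEStronglyMeasurable g μ) (hgC : ∀ x, ‖g x‖ ≤ C) (c : ℝ) :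
    ‖∫ x, Λ x • g x ∂μ - (∫ x, Λ x ∂μ) • ∫ x, g x ∂μ‖ ≤ 2 * C * ∫ x, |Λ x - c| ∂μ := by
  have hgint : Integrable g μ := .of_bound hg C (ae_of_all _ hgC)
  have hΛc : Integrable (fun x => Λ x - c) μ := hΛ.sub (integrable_const c)
  have hΛg : Integrable (fun x => Λ x • g x) μ := hΛ.smul_bdd C hg (ae_of_all _ hgC)
  have hcg : Integrable (fun x => c • g x) μ := hgint.smul c
  have hcenter : ∫ x, Λ x • g x ∂μ - (∫ x, Λ x ∂μ) • ∫ x, g x ∂μ =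
      ∫ x, (Λ x - c) • g x ∂μ - (∫ x, (Λ x - c) ∂μ) • ∫ x, g x ∂μ := by
    simp_rw [sub_smul]
    rw [integral_sub hΛg hcg, integral_smul, integral_sub hΛ (integrable_const c),
      integral_const, probReal_univ, one_smul, sub_smul]
    abel
  have hfst : ‖∫ x, (Λ x - c) • g x ∂μ‖ ≤ (∫ x, |Λ x - c| ∂μ) * C := by
    rw [← integral_mul_const]
    refine norm_integral_le_of_norm_le (hΛc.abs.mul_const C) (ae_of_all _ fun x => ?_)
    rw [norm_smul, Real.norm_eq_abs]
    exact mul_le_mul_of_nonneg_left (hgC x) (abs_nonneg _)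
  have hsnd : ‖(∫ x, (Λ x - c) ∂μ) • ∫ x, g x ∂μ‖ ≤ (∫ x, |Λ x - c| ∂μ) * C := by
    rw [norm_smul]
    refine mul_le_mul (norm_integral_le_integral_norm _) ?_ (norm_nonneg _)
      (integral_nonneg fun _ => abs_nonneg _)
    simpa using norm_integral_le_of_norm_le_const (μ := μ) (ae_of_all _ hgC)
  rw [hcenter]
  linarith [norm_sub_le (∫ x, (Λ x - c) • g x ∂μ) ((∫ x, (Λ x - c) ∂μ) • ∫ x, g x ∂μ)]

lemma norm_inv_integral_smul_sub_integral_le {Λ : α → ℝ} {g : α → E} {C : ℝ}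
    (hΛ : Integrable Λ μ) (hΛpos : 0 < ∫ x, Λ x ∂μ) (hg : AEStronglyMeasurable g μ)
    (hgC : ∀ x, ‖g x‖ ≤ C) (c : ℝ) :
    ‖(∫ x, Λ x ∂μ)⁻¹ • ∫ x, Λ x • g x ∂μ - ∫ x, g x ∂μ‖ ≤
      2 * C * (∫ x, |Λ x - c| ∂μ) / ∫ x, Λ x ∂μ := by
  have hfactor : (∫ x, Λ x ∂μ)⁻¹ • ∫ x, Λ x • g x ∂μ - ∫ x, g x ∂μ =
      (∫ x, Λ x ∂μ)⁻¹ • (∫ x, Λ x • g x ∂μ - (∫ x, Λ x ∂μ) • ∫ x, g x ∂μ) := by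
    rw [smul_sub, inv_smul_smul₀ hΛpos.ne']
  rw [hfactor, norm_smul, norm_inv, Real.norm_of_nonneg hΛpos.le, inv_mul_eq_div]
  exact div_le_div_of_nonneg_right (norm_integral_smul_sub_smul_integral_le hΛ hg hgC c) hΛpos.le

end Weights

/-! ### Convergence along varying probability spaces -/

section Convergence

variable {Ω : ℕ → Type*} [∀ n, MeasurableSpace (Ω n)] {P : ∀ n, Measure (Ω n)}

/-- Convergence to `0` in probability of real random variables that may all live on different
probability spaces, a case that `TendstoInMeasure` does not cover. -/
def VanishesInProb (P : ∀ n, Measure (Ω n)) (W : ∀ n, Ω n → ℝ) : Prop :=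
  ∀ δ : ℝ, 0 < δ → Tendsto (fun n => P n {ω | δ < |W n ω|}) atTop (𝓝 0)

lemma VanishesInProb.tendsto_measureReal {W : ∀ n, Ω n → ℝ} (hW : VanishesInProb P W) {δ : ℝ}
    (hδ : 0 < δ) : Tendsto (fun n => (P n).real {ω | δ < |W n ω|}) atTop (𝓝 0) :=
  (ENNReal.tendsto_toReal ENNReal.zero_ne_top).comp (hW δ hδ)

lemma VanishesInProb.of_forall_le {W W' : ∀ n, Ω n → ℝ} (hW : VanishesInProb P W)
    (h : ∀ δ : ℝ, 0 < δ → ∀ p : ℝ≥0∞, 0 < p → ∃ δ' : ℝ, 0 < δ' ∧ ∀ᶠ n in atTop,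
      ∃ A : Set (Ω n), P n A ≤ p ∧ ∀ ω ∉ A, |W n ω| ≤ δ' → |W' n ω| ≤ δ) :
    VanishesInProb P W' := by
  intro δ hδ
  refine ENNReal.tendsto_nhds_zero.2 fun p hp => ?_
  obtain ⟨δ', hδ', hA⟩ := h δ hδ (p / 2) (ENNReal.half_pos hp.ne')
  filter_upwards [hA, ENNReal.tendsto_nhds_zero.1 (hW δ' hδ') _ (ENNReal.half_pos hp.ne')]
    with n ⟨A, hAp, himp⟩ hn
  calc P n {ω | δ < |W' n ω|} ≤ P n (A ∪ {ω | δ' < |W n ω|}) := by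
        refine measure_mono fun ω hω => ?_
        by_contra hnot
        rw [Set.mem_union, not_or] at hnot
        exact (not_le.2 hω) (himp ω hnot.1 (not_lt.1 hnot.2))
    _ ≤ p / 2 + p / 2 := (measure_union_le _ _).trans (add_le_add hAp hn)
    _ = p := ENNReal.add_halves p

lemma VanishesInProb.add {W W' : ∀ n, Ω n → ℝ} (hW : VanishesInProb P W)
    (hW' : VanishesInProb P W') : VanishesInProb P fun n ω => W n ω + W' n ω := by
  refine hW.of_forall_le fun δ hδ p hp => ⟨δ / 2, half_pos hδ, ?_⟩
  filter_upwards [ENNReal.tendsto_nhds_zero.1 (hW' (δ / 2) (half_pos hδ)) p hp] with n hn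
  exact ⟨_, hn, fun ω hω hWω => (abs_add_le _ _).trans (by
    linarith [not_lt.1 (show ¬ δ / 2 < |W' n ω| from hω)])⟩

lemma VanishesInProb.abs {W : ∀ n, Ω n → ℝ} (hW : VanishesInProb P W) :
    VanishesInProb P fun n ω => |W n ω| := by
  simpa only [VanishesInProb, abs_abs] using hW

lemma VanishesInProb.finset_sum {ι : Type*} {s : Finset ι} {W : ι → ∀ n, Ω n → ℝ}
    (hW : ∀ i ∈ s, VanishesInProb P (W i)) : VanishesInProb P fun n ω => ∑ i ∈ s, W i n ω := by
  induction s using Finset.cons_induction with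
  | empty => exact fun δ hδ => by simp [not_lt.2 hδ.le]
  | cons i s hi ih =>
    simp only [Finset.sum_cons]
    exact (hW i (Finset.mem_cons_self i s)).add
      (ih fun j hj => hW j (Finset.mem_cons_of_mem hj))

lemma VanishesInProb.tendsto_integral_abs [∀ n, IsProbabilityMeasure (P n)] {W : ∀ n, Ω n → ℝ}
    (hW : VanishesInProb P W) (hm : ∀ n, AEMeasurable (W n) (P n)) {C : ℝ}
    (hC : ∀ n ω, |W n ω| ≤ C) : Tendsto (fun n => ∫ ω, |W n ω| ∂P n) atTop (𝓝 0) := by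
  refine tendsto_order.2 ⟨fun b hb => .of_forall fun n =>
    hb.trans_le (integral_nonneg fun _ => abs_nonneg _), fun η hη => ?_⟩
  have hsmall := (hW.tendsto_measureReal (half_pos hη)).const_mul C
  rw [mul_zero] at hsmall
  filter_upwards [hsmall.eventually (gt_mem_nhds (half_pos hη))] with n hn
  have hint : Integrable (fun ω => |W n ω|) (P n) :=
    .of_bound (hm n).abs.aestronglyMeasurable C (ae_of_all _ fun ω => by simpa using hC n ω)
  linarith [integral_le_add_mul_measureReal hint (A := {ω | η / 2 < |W n ω|}) (a := η / 2) (b := C)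
    (nullMeasurableSet_lt aemeasurable_const (hm n).abs) (fun ω hω => not_lt.1 hω)
    fun ω _ => (hC n ω).trans (by linarith)]

lemma VanishesInProb.cond [∀ n, IsFiniteMeasure (P n)] {W : ∀ n, Ω n → ℝ}
    (hW : VanishesInProb P W) {A : ∀ n, Set (Ω n)} (hAm : ∀ n, MeasurableSet (A n)) {c : ℝ}
    (hc : 0 < c) (hA : ∀ᶠ n in atTop, c ≤ (P n).real (A n)) :
    VanishesInProb (fun n => (P n)[|A n]) W := by
  intro δ hδ
  have hlim := ENNReal.Tendsto.const_mul (a := (ENNReal.ofReal c)⁻¹) (hW δ hδ)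
    (Or.inr (ENNReal.inv_ne_top.2 (ENNReal.ofReal_pos.2 hc).ne'))
  rw [mul_zero] at hlim
  refine tendsto_of_tendsto_of_tendsto_of_le_of_le' tendsto_const_nhds hlim
    (.of_forall fun _ => zero_le) ?_
  filter_upwards [hA] with n hn
  rw [cond_apply (hAm n)]
  exact mul_le_mul (ENNReal.inv_le_inv.2 (ENNReal.ofReal_le_of_le_toReal hn))
    (measure_mono Set.inter_subset_right) zero_le zero_le

lemma abs_integral_comp_sub_integral_comp_le {α : Type*} [MeasurableSpace α] {μ : Measure α}
    [IsProbabilityMeasure μ] {U V : α → ℝ} (hU : AEMeasurable U μ) (hV : AEMeasurable V μ)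
    {F : ℝ → ℝ} {K : ℝ≥0} (hK : LipschitzWith K F) {C : ℝ} (hC : ∀ x y, dist (F x) (F y) ≤ C)
    {δ : ℝ} (hδ : 0 ≤ δ) :
    |∫ ω, F (V ω) ∂μ - ∫ ω, F (U ω) ∂μ| ≤ K * δ + C * μ.real {ω | δ < |V ω - U ω|} := by
  have hint : ∀ {W : α → ℝ}, AEMeasurable W μ → Integrable (fun ω => F (W ω)) μ := fun hW =>
    .of_bound (hK.continuous.measurable.comp_aemeasurable hW).aestronglyMeasurable (‖F 0‖ + C)
      (ae_of_all _ fun ω => (norm_le_norm_add_norm_sub' _ (F 0)).trans (by gcongr; exact hC _ _))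
  rw [← integral_sub (hint hV) (hint hU)]
  refine abs_integral_le_integral_abs.trans (integral_le_add_mul_measureReal
    ((hint hV).sub (hint hU)).abs (nullMeasurableSet_lt aemeasurable_const (by fun_prop))
    (fun ω hω => (hK.dist_le_mul _ _).trans ?_) fun ω _ => (hC _ _).trans ?_)
  · exact mul_le_mul_of_nonneg_left (not_lt.1 hω) K.coe_nonneg
  · exact le_add_of_nonneg_left (by positivity)

/-- Mathlib's version of Slutsky's theorem needs all variables on one probability space. -/
lemma tendstoInDistribution_of_vanishesInProb_sub [∀ n, IsProbabilityMeasure (P n)]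
    {Ω' : Type*} [MeasurableSpace Ω'] {μ : Measure Ω'} [IsProbabilityMeasure μ]
    {U V : ∀ n, Ω n → ℝ} {Z : Ω' → ℝ} (hU : TendstoInDistribution U atTop Z P μ)
    (hV : ∀ n, AEMeasurable (V n) (P n)) (hVU : VanishesInProb P fun n ω => V n ω - U n ω) :
    TendstoInDistribution V atTop Z P μ where
  forall_aemeasurable := hV
  aemeasurable_limit := hU.aemeasurable_limit
  tendsto := by
    refine tendsto_iff_forall_lipschitz_integral_tendsto.2 fun F ⟨C, hC⟩ ⟨K, hK⟩ => ?_
    refine (tendsto_iff_forall_lipschitz_integral_tendsto.1 hU.tendsto F ⟨C, hC⟩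
      ⟨K, hK⟩).congr_dist (Metric.tendsto_nhds.2 fun η hη => ?_)
    have hδ : 0 < η / (2 * (K + 1)) := by positivity
    have hKδ : K * (η / (2 * (K + 1))) ≤ η / 2 := by
      rw [mul_div_assoc', div_le_div_iff₀ (by positivity) two_pos]
      nlinarith
    have hsmall := (hVU.tendsto_measureReal hδ).const_mul C
    rw [mul_zero] at hsmall
    filter_upwards [hsmall.eventually (gt_mem_nhds (half_pos hη))] with n hn
    have hFm {W : Ω n → ℝ} : AEStronglyMeasurable F ((P n).map W) :=
      hK.continuous.aestronglyMeasurable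
    simp only [ProbabilityMeasure.coe_mk, dist_zero_right, Real.norm_eq_abs]
    rw [integral_map (hU.forall_aemeasurable n) hFm, integral_map (hV n) hFm, Real.dist_eq,
      abs_abs, abs_sub_comm]
    linarith [abs_integral_comp_sub_integral_comp_le (hU.forall_aemeasurable n) (hV n) hK hC hδ.le]

lemma tendstoInDistribution_cond [∀ n, IsProbabilityMeasure (P n)] {Ω' : Type*}
    [MeasurableSpace Ω'] {μ : Measure Ω'} [IsProbabilityMeasure μ] {E : Type*}
    [TopologicalSpace E] [MeasurableSpace E] [OpensMeasurableSpace E] {U : ∀ n, Ω n → E}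
    {Z : Ω' → E} (hU : TendstoInDistribution U atTop Z P μ) {A : ∀ n, Set (Ω n)}
    [∀ n, IsProbabilityMeasure (P n)[|A n]] {c₀ : ℝ}
    (hc₀ : 0 < c₀) (hA : ∀ᶠ n in atTop, c₀ ≤ (P n).real (A n)) {Λ : ∀ n, Ω n → ℝ} {c : ℕ → ℝ}
    (hΛ : ∀ n, Integrable (Λ n) (P n))
    (hΛA : ∀ n (F : E →ᵇ ℝ), ∫ ω in A n, F (U n ω) ∂P n = ∫ ω, Λ n ω * F (U n ω) ∂P n)
    (hΛc : Tendsto (fun n => ∫ ω, |Λ n ω - c n| ∂P n) atTop (𝓝 0)) :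
    TendstoInDistribution U atTop Z (fun n => (P n)[|A n]) μ where
  forall_aemeasurable n := (hU.forall_aemeasurable n).mono_ac cond_absolutelyContinuous
  aemeasurable_limit := hU.aemeasurable_limit
  tendsto := by
    refine ProbabilityMeasure.tendsto_iff_forall_integral_tendsto.2 fun F => ?_
    refine (ProbabilityMeasure.tendsto_iff_forall_integral_tendsto.1 hU.tendsto F).congr_dist ?_
    have hlim := (hΛc.const_mul (2 * ‖F‖)).div_const c₀
    rw [mul_zero, zero_div] at hlim
    refine squeeze_zero' (.of_forall fun _ => dist_nonneg) ?_ hlim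
    filter_upwards [hA] with n hAn
    have hFm {ν : Measure E} : AEStronglyMeasurable F ν := F.continuous.aestronglyMeasurable
    have hmass : ∫ ω, Λ n ω ∂P n = (P n).real (A n) := by
      simpa using (hΛA n (.const E 1)).symm
    have hpos : 0 < ∫ ω, Λ n ω ∂P n := hmass ▸ hc₀.trans_le hAn
    have hUn := hU.forall_aemeasurable n
    simp only [ProbabilityMeasure.coe_mk]
    rw [integral_map hUn hFm, integral_map (hUn.mono_ac cond_absolutelyContinuous) hFm,
      ProbabilityTheory.cond, integral_smul_measure, hΛA n F, dist_comm, dist_eq_norm,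
      ENNReal.toReal_inv, ← measureReal_def, ← hmass]
    refine (norm_inv_integral_smul_sub_integral_le (hΛ n) hpos
      (F.continuous.aestronglyMeasurable.comp_aemeasurable hUn)
      (fun ω => F.norm_coe_le_norm _) (c n)).trans ?_
    gcongr
    exact hmass ▸ hAn

lemma tendstoInDistribution_congr_limit [∀ n, IsProbabilityMeasure (P n)] {Ω₁ Ω₂ : Type*}
    [MeasurableSpace Ω₁] [MeasurableSpace Ω₂] {μ₁ : Measure Ω₁} {μ₂ : Measure Ω₂}
    [IsProbabilityMeasure μ₁] [IsProbabilityMeasure μ₂] {E : Type*} [TopologicalSpace E]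
    [MeasurableSpace E] [OpensMeasurableSpace E] {U : ∀ n, Ω n → E} {Z₁ : Ω₁ → E} {Z₂ : Ω₂ → E}
    (hU : TendstoInDistribution U atTop Z₁ P μ₁) (hZ : IdentDistrib Z₁ Z₂ μ₁ μ₂) :
    TendstoInDistribution U atTop Z₂ P μ₂ where
  forall_aemeasurable := hU.forall_aemeasurable
  aemeasurable_limit := hZ.aemeasurable_snd
  tendsto := by
    convert hU.tendsto using 1
    exact congrArg 𝓝 (Subtype.ext hZ.map_eq.symm)

end Convergence

/-! ### A central limit theorem for bounded triangular arrays -/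

section CentralLimit

lemma norm_prod_sub_prod_le {ι : Type*} (s : Finset ι) {z w : ι → ℂ} (hz : ∀ i, ‖z i‖ ≤ 1)
    (hw : ∀ i, ‖w i‖ ≤ 1) : ‖∏ i ∈ s, z i - ∏ i ∈ s, w i‖ ≤ ∑ i ∈ s, ‖z i - w i‖ := by
  induction s using Finset.cons_induction with
  | empty => simp
  | cons a s ha ih =>
    have htelescope : (∏ i ∈ s.cons a ha, z i) - ∏ i ∈ s.cons a ha, w i =
        (z a - w a) * ∏ i ∈ s, z i + w a * (∏ i ∈ s, z i - ∏ i ∈ s, w i) := by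
      rw [Finset.prod_cons, Finset.prod_cons]; ring
    have hprod : ‖∏ i ∈ s, z i‖ ≤ 1 := by
      rw [norm_prod]; exact Finset.prod_le_one (fun i _ => norm_nonneg _) fun i _ => hz i
    rw [htelescope, Finset.sum_cons]
    refine (norm_add_le _ _).trans (add_le_add ?_ ?_)
    · rw [norm_mul]; exact mul_le_of_le_one_right (norm_nonneg _) hprod
    · rw [norm_mul]; exact (mul_le_of_le_one_left (norm_nonneg _) (hw a)).trans ih

lemma norm_exp_mul_I_taylor_le {x : ℝ} (hx : |x| ≤ 1) :
    ‖Complex.exp (x * Complex.I) - (1 + x * Complex.I - (x ^ 2 / 2 : ℝ))‖ ≤ |x| ^ 3 := by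
  have hnorm : ‖(x : ℂ) * Complex.I‖ = |x| := by simp
  have hbound := Complex.exp_bound' (x := x * Complex.I) (n := 3) (by
    rw [hnorm]; norm_num; linarith)
  have hsum : ∑ m ∈ Finset.range 3, ((x : ℂ) * Complex.I) ^ m / (m.factorial : ℂ) =
      1 + x * Complex.I - (x ^ 2 / 2 : ℝ) := by
    simp [Finset.sum_range_succ, mul_pow]
    ring
  rw [hnorm, hsum] at hbound
  refine hbound.trans ?_
  have hcube : 0 ≤ |x| ^ 3 := by positivity
  norm_num [Nat.factorial]
  linarith

variable {α : Type*} [MeasurableSpace α] {μ : Measure α} [IsProbabilityMeasure μ]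

lemma norm_charFun_map_sub_taylor_le {Z : α → ℝ} (hZ : AEMeasurable Z μ) (hZ1 : ∀ ω, |Z ω| ≤ 1)
    (hZ0 : ∫ ω, Z ω ∂μ = 0) {s : ℝ} (hs : |s| ≤ 1) :
    ‖charFun (μ.map Z) s - (1 - s ^ 2 * variance Z μ / 2 : ℝ)‖ ≤ |s| ^ 3 * variance Z μ := by
  have hint : Integrable Z μ := .of_bound hZ.aestronglyMeasurable 1 (ae_of_all _ hZ1)
  have hint2 : Integrable (fun ω => Z ω ^ 2) μ :=
    .of_bound (by fun_prop) 1 (ae_of_all _ fun ω => by simpa using hZ1 ω)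
  have hexp : Integrable (fun ω => Complex.exp ((s * Z ω : ℝ) * Complex.I)) μ :=
    .of_bound (by fun_prop) 1 (ae_of_all _ fun ω => (Complex.norm_exp_ofReal_mul_I _).le)
  have hvar : variance Z μ = ∫ ω, Z ω ^ 2 ∂μ := variance_of_integral_eq_zero hZ hZ0
  have hlin : Integrable (fun ω => ((s * Z ω : ℝ) : ℂ) * Complex.I) μ :=
    (hint.const_mul s).ofReal.mul_const _
  have hquad : Integrable (fun ω => (((s * Z ω) ^ 2 / 2 : ℝ) : ℂ)) μ := by
    simp_rw [mul_pow]; exact ((hint2.const_mul _).div_const 2).ofReal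
  have hone : Integrable (fun ω => 1 + ((s * Z ω : ℝ) : ℂ) * Complex.I) μ :=
    (integrable_const 1).add hlin
  have hpoly : Integrable
      (fun ω => 1 + ((s * Z ω : ℝ) : ℂ) * Complex.I - ((s * Z ω) ^ 2 / 2 : ℝ)) μ := hone.sub hquad
  have htaylor : ∫ ω, (1 + ((s * Z ω : ℝ) : ℂ) * Complex.I - ((s * Z ω) ^ 2 / 2 : ℝ)) ∂μ =
      (1 - s ^ 2 * variance Z μ / 2 : ℝ) := by
    rw [integral_sub hone hquad, integral_add (integrable_const 1) hlin,
      integral_mul_const, integral_complex_ofReal, integral_complex_ofReal, integral_const_mul, hZ0,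
      integral_div, hvar]
    simp_rw [mul_pow]
    rw [integral_const_mul]
    simp
  rw [charFun_apply_real, integral_map hZ (by fun_prop), ← htaylor]
  simp_rw [← Complex.ofReal_mul]
  rw [← integral_sub hexp hpoly, hvar, ← integral_const_mul]
  refine norm_integral_le_of_norm_le (hint2.const_mul _) (ae_of_all _ fun ω => ?_)
  have hsZ : |s * Z ω| ≤ 1 := by
    rw [abs_mul]; exact mul_le_one₀ hs (abs_nonneg _) (hZ1 ω)
  refine (norm_exp_mul_I_taylor_le hsZ).trans ?_
  rw [abs_mul, mul_pow, ← sq_abs (Z ω)]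
  exact mul_le_mul_of_nonneg_left (pow_le_pow_of_le_one (abs_nonneg _) (hZ1 ω) (by norm_num))
    (by positivity)

lemma norm_charFun_map_sub_exp_le {Z : α → ℝ} (hZ : AEMeasurable Z μ) (hZ1 : ∀ ω, |Z ω| ≤ 1)
    (hZ0 : ∫ ω, Z ω ∂μ = 0) {s : ℝ} (hs : |s| ≤ 1) :
    ‖charFun (μ.map Z) s - (Real.exp (-(s ^ 2 * variance Z μ / 2)) : ℂ)‖ ≤
      2 * |s| ^ 3 * variance Z μ := by
  have hv0 : 0 ≤ variance Z μ := variance_nonneg Z μ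
  have hv1 : variance Z μ ≤ 1 := by
    have hpop := variance_le_sq_of_bounded (a := -1) (b := 1)
      (ae_of_all μ fun ω => abs_le.1 (hZ1 ω)) hZ
    norm_num at hpop
    exact hpop
  have hs3 : s ^ 4 ≤ |s| ^ 3 := by
    rw [← Even.pow_abs (by decide : Even 4)]
    exact pow_le_pow_of_le_one (abs_nonneg _) hs (by norm_num)
  have hs2 : s ^ 2 ≤ 1 := (sq_le_one_iff_abs_le_one s).2 hs
  have hexp : |Real.exp (-(s ^ 2 * variance Z μ / 2)) - 1 - -(s ^ 2 * variance Z μ / 2)| ≤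
      |s| ^ 3 * variance Z μ := by
    refine (Real.abs_exp_sub_one_sub_id_le ?_).trans ?_
    · rw [abs_neg, abs_of_nonneg (by positivity)]
      nlinarith
    · nlinarith [mul_le_mul_of_nonneg_right hs3 hv0, mul_nonneg (pow_nonneg (abs_nonneg s) 3) hv0,
        mul_le_mul_of_nonneg_left hv1 (by positivity : 0 ≤ s ^ 4 * variance Z μ)]
  have hsplit : charFun (μ.map Z) s - (Real.exp (-(s ^ 2 * variance Z μ / 2)) : ℂ) =
      (charFun (μ.map Z) s - (1 - s ^ 2 * variance Z μ / 2 : ℝ)) -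
        (Real.exp (-(s ^ 2 * variance Z μ / 2)) - 1 - -(s ^ 2 * variance Z μ / 2) : ℝ) := by
    push_cast; ring
  rw [hsplit]
  refine (norm_sub_le _ _).trans ?_
  rw [Complex.norm_real, Real.norm_eq_abs]
  linarith [norm_charFun_map_sub_taylor_le hZ hZ1 hZ0 hs]

lemma norm_charFun_map_sum_sub_exp_le {ι : Type*} [Fintype ι] {Z : ι → α → ℝ}
    (hZ : ∀ i, AEMeasurable (Z i) μ) (hZ1 : ∀ i ω, |Z i ω| ≤ 1) (hZ0 : ∀ i, ∫ ω, Z i ω ∂μ = 0)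
    (hindep : iIndepFun Z μ) {s : ℝ} (hs : |s| ≤ 1) :
    ‖charFun (μ.map fun ω => ∑ i, Z i ω) s -
        (Real.exp (-(s ^ 2 * (∑ i, variance (Z i) μ) / 2)) : ℂ)‖ ≤
      2 * |s| ^ 3 * ∑ i, variance (Z i) μ := by
  have hprod : (Real.exp (-(s ^ 2 * (∑ i, variance (Z i) μ) / 2)) : ℂ) =
      ∏ i, (Real.exp (-(s ^ 2 * variance (Z i) μ / 2)) : ℂ) := by
    rw [Finset.mul_sum, Finset.sum_div, ← Finset.sum_neg_distrib, Real.exp_sum]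
    push_cast; rfl
  have hle : ∀ i, ‖(Real.exp (-(s ^ 2 * variance (Z i) μ / 2)) : ℂ)‖ ≤ 1 := fun i => by
    rw [Complex.norm_real, Real.norm_of_nonneg (Real.exp_pos _).le, Real.exp_le_one_iff]
    have := variance_nonneg (Z i) μ
    exact neg_nonpos.2 (by positivity)
  have := fun i => Measure.isProbabilityMeasure_map (hZ i)
  rw [hindep.charFun_map_fun_sum_eq_prod hZ, Finset.prod_apply, hprod, Finset.mul_sum]
  exact (norm_prod_sub_prod_le _ (fun _ => norm_charFun_le_one _) hle).trans
    (Finset.sum_le_sum fun i _ => norm_charFun_map_sub_exp_le (hZ i) (hZ1 i) (hZ0 i) hs)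

theorem tendstoInDistribution_sum_div_sqrt_variance {Ω : ℕ → Type*} [∀ n, MeasurableSpace (Ω n)]
    {P : ∀ n, Measure (Ω n)} [∀ n, IsProbabilityMeasure (P n)] {ι : ℕ → Type*} [∀ n, Fintype (ι n)]
    {Z : ∀ n, ι n → Ω n → ℝ} (hZ : ∀ n i, AEMeasurable (Z n i) (P n))
    (hZ1 : ∀ n i ω, |Z n i ω| ≤ 1) (hZ0 : ∀ n i, ∫ ω, Z n i ω ∂P n = 0)
    (hindep : ∀ n, iIndepFun (Z n) (P n))
    (hvar : Tendsto (fun n => ∑ i, variance (Z n i) (P n)) atTop atTop) :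
    TendstoInDistribution
      (fun n ω => (∑ i, Z n i ω) / √(∑ i, variance (Z n i) (P n))) atTop id P
      (gaussianReal 0 1) where
  forall_aemeasurable n := (Finset.aemeasurable_fun_sum _ fun i _ => hZ n i).div_const _
  aemeasurable_limit := aemeasurable_id
  tendsto := by
    refine ProbabilityMeasure.tendsto_iff_tendsto_charFun.2 fun t => ?_
    have hsqrt := Real.tendsto_sqrt_atTop.comp hvar
    rw [tendsto_iff_norm_sub_tendsto_zero]
    refine squeeze_zero' (Eventually.of_forall fun _ => norm_nonneg _) ?_
      (hsqrt.const_div_atTop (2 * |t| ^ 3))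
    filter_upwards [hsqrt.eventually_gt_atTop 0, hsqrt.eventually_ge_atTop |t|] with n hpos ht
    simp only [Function.comp_apply, ProbabilityMeasure.coe_mk] at hpos ht ⊢
    set V := ∑ i, variance (Z n i) (P n)
    have hVsq : √V ^ 2 = V := Real.sq_sqrt (Real.sqrt_pos.1 hpos).le
    have hs : |(√V)⁻¹ * t| ≤ 1 := by
      rw [abs_mul, abs_of_pos (inv_pos.2 hpos), inv_mul_le_one₀ hpos]; exact ht
    have hexp : charFun ((gaussianReal 0 1).map id) t =
        (Real.exp (-(((√V)⁻¹ * t) ^ 2 * V / 2)) : ℂ) := by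
      have hst : ((√V)⁻¹ * t) ^ 2 * V = t ^ 2 := by
        rw [← hVsq]; field_simp; simp
      rw [Measure.map_id, charFun_gaussianReal, hst]
      push_cast; simp
    have hbound := norm_charFun_map_sum_sub_exp_le (hZ n) (hZ1 n) (hZ0 n) (hindep n) hs
    simp_rw [div_eq_inv_mul]
    rw [charFun_map_mul_comp (Finset.aemeasurable_fun_sum _ fun i _ => hZ n i), hexp]
    refine hbound.trans_eq ?_
    rw [abs_mul, abs_of_pos (inv_pos.2 hpos)]
    change _ * V = _
    rw [← hVsq, Real.sqrt_sq hpos.le]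
    field_simp

end CentralLimit

/-! ### Softmax weights -/

section Softmax

variable {ι : Type*} [Fintype ι]

/-- The softmax weights of the scores `a`: the law of the exponential mechanism that draws `i` with
probability proportional to `exp (a i)`. -/
def softmax (a : ι → ℝ) (i : ι) : ℝ := Real.exp (a i) / ∑ j, Real.exp (a j)

lemma sum_exp_pos (a : ι → ℝ) (i : ι) : 0 < ∑ j, Real.exp (a j) :=
  Finset.sum_pos (fun _ _ => Real.exp_pos _) ⟨i, Finset.mem_univ i⟩

lemma softmax_pos (a : ι → ℝ) (i : ι) : 0 < softmax a i :=
  div_pos (Real.exp_pos _) (sum_exp_pos a i)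

lemma softmax_le_one (a : ι → ℝ) (i : ι) : softmax a i ≤ 1 :=
  (div_le_one (sum_exp_pos a i)).2
    (Finset.single_le_sum (f := fun j => Real.exp (a j)) (fun _ _ => (Real.exp_pos _).le)
      (Finset.mem_univ i))

lemma softmax_le_exp_mul_softmax {a b : ι → ℝ} {τ : ℝ} (h : ∀ j, |a j - b j| ≤ τ) (i : ι) :
    softmax a i ≤ Real.exp (2 * τ) * softmax b i := by
  have hnum : Real.exp (a i) ≤ Real.exp τ * Real.exp (b i) := by
    rw [← Real.exp_add, Real.exp_le_exp]
    linarith [(abs_le.1 (h i)).2]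
  have hden : ∑ j, Real.exp (b j) ≤ Real.exp τ * ∑ j, Real.exp (a j) := by
    rw [Finset.mul_sum]
    refine Finset.sum_le_sum fun j _ => ?_
    rw [← Real.exp_add, Real.exp_le_exp]
    linarith [(abs_le.1 (h j)).1]
  rw [softmax, softmax, mul_div_assoc', div_le_div_iff₀ (sum_exp_pos a i) (sum_exp_pos b i),
    two_mul, Real.exp_add]
  calc Real.exp (a i) * ∑ j, Real.exp (b j)
      ≤ (Real.exp τ * Real.exp (b i)) * (Real.exp τ * ∑ j, Real.exp (a j)) := by gcongr
    _ = Real.exp τ * Real.exp τ * Real.exp (b i) * ∑ j, Real.exp (a j) := by ring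

lemma exp_neg_div_card_le_softmax {a : ι → ℝ} {C : ℝ} (ha : ∀ j, |a j| ≤ C) (i : ι) :
    Real.exp (-(2 * C)) / Fintype.card ι ≤ softmax a i := by
  calc Real.exp (-(2 * C)) / Fintype.card ι = (Real.exp (2 * C))⁻¹ * softmax 0 i := by
        simp [softmax, Real.exp_neg, div_eq_mul_inv]
    _ ≤ softmax a i := (inv_mul_le_iff₀ (Real.exp_pos _)).2
        (softmax_le_exp_mul_softmax (fun j => by simpa using ha j) i)

variable {κ : ι → Type*} [∀ h, Fintype (κ h)]

lemma prod_softmax_le_exp_mul {a b : ∀ h, κ h → ℝ} {τ : ι → ℝ}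
    (hab : ∀ h j, |a h j - b h j| ≤ τ h) (i : ∀ h, κ h) :
    ∏ h, softmax (a h) (i h) ≤ Real.exp (2 * ∑ h, τ h) * ∏ h, softmax (b h) (i h) := by
  rw [Finset.mul_sum, Real.exp_sum, ← Finset.prod_mul_distrib]
  exact Finset.prod_le_prod (fun h _ => (softmax_pos _ _).le) fun h _ =>
    softmax_le_exp_mul_softmax (hab h) (i h)

lemma prod_softmax_le_one (a : ∀ h, κ h → ℝ) (i : ∀ h, κ h) : ∏ h, softmax (a h) (i h) ≤ 1 :=
  Finset.prod_le_one (fun _ _ => (softmax_pos _ _).le) fun _ _ => softmax_le_one _ _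

lemma abs_prod_softmax_sub_le {a b : ∀ h, κ h → ℝ} {τ : ι → ℝ}
    (hab : ∀ h j, |a h j - b h j| ≤ τ h) (i : ∀ h, κ h) :
    |∏ h, softmax (a h) (i h) - ∏ h, softmax (b h) (i h)| ≤ Real.exp (2 * ∑ h, τ h) - 1 := by
  have hba : ∀ h j, |b h j - a h j| ≤ τ h := fun h j => abs_sub_comm (a h j) _ ▸ hab h j
  have hexp : 1 ≤ Real.exp (2 * ∑ h, τ h) := by
    have : ∀ h, 0 ≤ τ h := fun h => (abs_nonneg _).trans (hab h (i h))
    exact Real.one_le_exp (mul_nonneg zero_le_two (Finset.sum_nonneg fun h _ => this h))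
  rw [abs_sub_le_iff]
  constructor <;> nlinarith [prod_softmax_le_exp_mul hab i, prod_softmax_le_exp_mul hba i,
    prod_softmax_le_one a i, prod_softmax_le_one b i]

end Softmax

/-! ### Counts, proportions and gains -/

section Sample

variable {𝒳 : Type*} {n : ℕ} (x : Fin n → 𝒳)

lemma count_mono {R R' : Set 𝒳} (h : R ⊆ R') : count x R ≤ count x R' :=
  Finset.card_le_card fun i hi => by
    simp only [Finset.mem_filter_univ] at hi ⊢
    exact h hi

open Classical in
lemma sum_ite_mem (R : Set 𝒳) : ∑ i, (if x i ∈ R then (1 : ℝ) else 0) = count x R := by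
  simp [count, Finset.sum_boole]

lemma count_diff {P C : Set 𝒳} (h : C ⊆ P) : (count x (P \ C) : ℝ) = count x P - count x C := by
  classical
  rw [← sum_ite_mem, ← sum_ite_mem, ← sum_ite_mem, ← Finset.sum_sub_distrib]
  refine Finset.sum_congr rfl fun i _ => ?_
  by_cases hC : x i ∈ C
  · simp [hC, h hC]
  · simp [hC]

open Classical in
/-- The average of `f` over the observations in the region `R`, which is `0` if there are none; the
sample proportion `prop` is the case of binary `f`. -/
def avg (f : Fin n → ℝ) (R : Set 𝒳) : ℝ :=
  (1 / (count x R : ℝ)) * ∑ i, f i * (if x i ∈ R then 1 else 0)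

lemma prop_eq_avg (y : Fin n → Bool) (R : Set 𝒳) :
    prop x y R = avg x (fun i => ((y i).toNat : ℝ)) R := rfl

open Classical in
lemma count_mul_avg (f : Fin n → ℝ) (R : Set 𝒳) :
    (count x R : ℝ) * avg x f R = ∑ i, f i * (if x i ∈ R then 1 else 0) := by
  rcases eq_or_ne (count x R) 0 with h | h
  · have hmem : ∀ i, x i ∉ R := by
      simpa only [count, Finset.card_eq_zero, Finset.filter_eq_empty_iff, Finset.mem_univ,
        true_imp_iff] using h
    simp [h, hmem]
  · rw [avg, ← mul_assoc, mul_one_div_cancel (by exact_mod_cast h), one_mul]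

lemma avg_mem_Icc {f : Fin n → ℝ} {a b : ℝ} (hf : ∀ i, f i ∈ Set.Icc a b) {R : Set 𝒳}
    (hR : 0 < count x R) : avg x f R ∈ Set.Icc a b := by
  classical
  have hR0 : (0 : ℝ) < count x R := by exact_mod_cast hR
  refine ⟨le_of_mul_le_mul_left ?_ hR0, le_of_mul_le_mul_left ?_ hR0⟩ <;>
    rw [count_mul_avg, ← sum_ite_mem, Finset.sum_mul] <;>
    refine Finset.sum_le_sum fun i _ => ?_ <;> rw [mul_comm] <;> gcongr
  exacts [(hf i).1, (hf i).2]

lemma count_mul_prop_diff (y : Fin n → Bool) {P C : Set 𝒳} (h : C ⊆ P) :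
    (count x (P \ C) : ℝ) * prop x y (P \ C) =
      count x P * prop x y P - count x C * prop x y C := by
  classical
  rw [prop_eq_avg, prop_eq_avg, prop_eq_avg, count_mul_avg, count_mul_avg, count_mul_avg,
    ← Finset.sum_sub_distrib]
  refine Finset.sum_congr rfl fun i _ => ?_
  by_cases hC : x i ∈ C
  · simp [hC, h hC]
  · simp [hC]

open Classical in
/-- The contribution of the observation `i`, with outcome `b`, to the deviation of the number of
successes in the region `R` from its mean, when the success probabilities are `θ`. -/
def residual (θ : Fin n → ℝ) (R : Set 𝒳) (i : Fin n) (b : Bool) : ℝ :=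
  ((b.toNat : ℝ) - θ i) * (if x i ∈ R then 1 else 0)

lemma sum_residual (θ : Fin n → ℝ) (R : Set 𝒳) (y : Fin n → Bool) :
    ∑ i, residual x θ R i (y i) = count x R * (prop x y R - avg x θ R) := by
  classical
  rw [mul_sub, prop_eq_avg, count_mul_avg, count_mul_avg, ← Finset.sum_sub_distrib]
  simp only [residual, sub_mul]

lemma abs_residual_le_one {θ : Fin n → ℝ} {i : Fin n} (hθ : θ i ∈ Set.Icc 0 1) (R : Set 𝒳)
    (b : Bool) : |residual x θ R i b| ≤ 1 := by
  obtain ⟨h0, h1⟩ := hθ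
  rw [residual, abs_le]
  cases b <;> split_ifs <;> constructor <;> simp <;> linarith

/-- The gain of the split of `P` into `C` and `P \ C` when the impurity of a region `R` is `J R`,
so that `gain I x y` is the case `J R = I (prop x y R)`. -/
def impurityGain (J : Set 𝒳 → ℝ) (P C : Set 𝒳) : ℝ :=
  J P - ((count x C : ℝ) / count x P * J C + (count x (P \ C) : ℝ) / count x P * J (P \ C))

lemma impurityGain_sub (J J' : Set 𝒳 → ℝ) (P C : Set 𝒳) :
    impurityGain x J P C - impurityGain x J' P C =
      impurityGain x (fun R => J R - J' R) P C := by
  simp only [impurityGain]; ring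

lemma abs_impurityGain_le {J : Set 𝒳 → ℝ} {B : ℝ} {P C : Set 𝒳} (h : C ⊆ P) (hP : |J P| ≤ B)
    (hC : |J C| ≤ B) (hD : |J (P \ C)| ≤ B) : |impurityGain x J P C| ≤ 2 * B := by
  have hweights : (count x C : ℝ) / count x P + (count x (P \ C) : ℝ) / count x P ≤ 1 := by
    rw [← add_div, count_diff x h, add_sub_cancel]
    exact div_self_le_one _
  have hB : 0 ≤ B := (abs_nonneg _).trans hP
  calc |impurityGain x J P C|
      ≤ |J P| + ((count x C : ℝ) / count x P * |J C| +
          (count x (P \ C) : ℝ) / count x P * |J (P \ C)|) := by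
        refine (abs_sub _ _).trans (add_le_add_right ((abs_add_le _ _).trans_eq ?_) _)
        simp only [abs_mul, abs_div, Nat.abs_cast]
    _ ≤ B + ((count x C : ℝ) / count x P * B + (count x (P \ C) : ℝ) / count x P * B) := by gcongr
    _ ≤ 2 * B := by nlinarith

/-! ### The gains as functions of the key statistics -/

/-- The proportion of the region `R`, when the first key statistic is moved to the value `u` and
the orthogonalized proportions are kept fixed. -/
def shiftedProp (y : Fin n → Bool) (l : Set 𝒳) (u : ℝ) (R : Set 𝒳) : ℝ :=
  prop x y R + (count x (R ∩ l) : ℝ) / (count x R * √(count x l)) *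
    (u - √(count x l) * prop x y l)

lemma abs_shiftedProp_sub_prop_le (y : Fin n → Bool) (l : Set 𝒳) (u : ℝ) (R : Set 𝒳) :
    |shiftedProp x y l u R - prop x y R| ≤ |u - √(count x l) * prop x y l| / √(count x l) := by
  have hratio : (count x (R ∩ l) : ℝ) / count x R ≤ 1 :=
    div_le_one_of_le₀ (by exact_mod_cast count_mono x Set.inter_subset_left) (Nat.cast_nonneg _)
  rw [shiftedProp, add_sub_cancel_left, ← div_div, abs_mul, abs_of_nonneg (by positivity),
    div_mul_eq_mul_div]
  gcongr
  exact mul_le_of_le_one_left (abs_nonneg _) hratio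

lemma orthProp_self (y : Fin n → Bool) (l : Set 𝒳) : orthProp x y l l = 0 := by
  rw [orthProp, Set.inter_self, Real.sqrt_mul_self (Nat.cast_nonneg _)]
  rcases eq_or_ne (count x l : ℝ) 0 with h | h
  · simp [h]
  · rw [div_self h]; ring

variable (y : Fin n → Bool) {l R P C : Set 𝒳} (u : ℝ)

lemma count_mul_shiftedProp (hl : 0 < count x l) (hR : 0 < count x R) :
    count x R * shiftedProp x y l u R =
      √(count x R) * orthProp x y l R + count x (R ∩ l) / √(count x l) * u := by
  have horth : √(count x R) * orthProp x y l R =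
      √(count x R) ^ 2 * prop x y R - count x (R ∩ l) * prop x y l := by
    rw [orthProp, Real.sqrt_mul (Nat.cast_nonneg _)]
    field_simp
  rw [horth, Real.sq_sqrt (Nat.cast_nonneg _), shiftedProp]
  field_simp
  ring

lemma count_diff_mul_shiftedProp (hCP : C ⊆ P) (hC : 0 < count x C)
    (hD : 0 < count x (P \ C)) :
    (count x (P \ C) : ℝ) * shiftedProp x y l u (P \ C) =
      count x P * shiftedProp x y l u P - count x C * shiftedProp x y l u C := by
  have hinter : (count x (P \ C ∩ l) : ℝ) = count x (P ∩ l) - count x (C ∩ l) := by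
    rw [← count_diff x (Set.inter_subset_inter_left l hCP), Set.inter_sdiff_distrib_right]
  have hP0 : (count x P : ℝ) ≠ 0 := by exact_mod_cast (hC.trans_le (count_mono x hCP)).ne'
  have hC0 : (count x C : ℝ) ≠ 0 := by exact_mod_cast hC.ne'
  have hD0 : (count x (P \ C) : ℝ) ≠ 0 := by exact_mod_cast hD.ne'
  have hexpand : ∀ R : Set 𝒳, (count x R : ℝ) ≠ 0 → count x R * shiftedProp x y l u R =
      count x R * prop x y R +
        count x (R ∩ l) * ((u - √(count x l) * prop x y l) / √(count x l)) := fun R hR => by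
    rw [shiftedProp, mul_add, ← div_div, div_eq_mul_inv (_ / _) √_]
    field_simp
  rw [hexpand _ hP0, hexpand _ hC0, hexpand _ hD0, count_mul_prop_diff x y hCP, hinter]
  ring

lemma scaling_parent (hlP : l ⊆ P) (hl : 0 < count x l) :
    scaling x l P C 0 * u + scaling x l P C 1 * orthProp x y l P = shiftedProp x y l u P := by
  have hP : 0 < count x P := hl.trans_le (count_mono x hlP)
  have hP0 : (count x P : ℝ) ≠ 0 := by exact_mod_cast hP.ne'
  refine mul_left_cancel₀ hP0 ?_
  rw [count_mul_shiftedProp x y u hl hP, Set.inter_eq_right.2 hlP, Real.div_sqrt]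
  simp only [scaling, Matrix.cons_val]
  rw [mul_add, ← mul_assoc, ← mul_assoc, mul_div_cancel₀ _ hP0, mul_one_div, Real.div_sqrt,
    add_comm]

lemma scaling_child (hl : 0 < count x l) (hC : 0 < count x C) :
    scaling x l P C 2 * u + scaling x l P C 3 * orthProp x y l C = shiftedProp x y l u C := by
  have hC0 : (count x C : ℝ) ≠ 0 := by exact_mod_cast hC.ne'
  refine mul_left_cancel₀ hC0 ?_
  rw [count_mul_shiftedProp x y u hl hC]
  simp only [scaling, Matrix.cons_val]
  rw [mul_add, ← mul_assoc, ← mul_assoc, ← div_div, mul_one_div, Real.div_sqrt, mul_div_assoc',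
    mul_div_cancel₀ _ hC0, add_comm]

lemma scaling_complement (hCP : C ⊆ P) (hl : 0 < count x l) (hC : 0 < count x C)
    (hD : 0 < count x (P \ C)) :
    scaling x l P C 4 * u + scaling x l P C 5 * orthProp x y l P +
      scaling x l P C 6 * orthProp x y l C = shiftedProp x y l u (P \ C) := by
  have hD0 : (count x P - count x C : ℝ) ≠ 0 := by
    rw [← count_diff x hCP]; exact_mod_cast hD.ne'
  have hl' : √(count x l : ℝ) ≠ 0 := (Real.sqrt_pos.2 (by exact_mod_cast hl)).ne'
  refine mul_left_cancel₀ hD0 ?_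
  rw [← count_diff x hCP, count_diff_mul_shiftedProp x y u hCP hC hD,
    count_mul_shiftedProp x y u hl (hC.trans_le (count_mono x hCP)),
    count_mul_shiftedProp x y u hl hC, count_diff x hCP]
  simp only [scaling, Matrix.cons_val]
  field_simp
  ring

lemma scaledGain_scaling (I : ℝ → ℝ) (hCP : C ⊆ P) (hlP : l ⊆ P) (hl : 0 < count x l)
    (hC : 0 < count x C) (hD : 0 < count x (P \ C)) :
    scaledGain I (scaling x l P C) (u, orthProp x y l P, orthProp x y l C) =
      impurityGain x (fun R => I (shiftedProp x y l u R)) P C := by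
  have hP0 : (count x P : ℝ) ≠ 0 := by exact_mod_cast (hC.trans_le (count_mono x hCP)).ne'
  have hweight : 1 - scaling x l P C 7 = (count x (P \ C) : ℝ) / count x P := by
    simp only [scaling, Matrix.cons_val]
    rw [count_diff x hCP, sub_div, div_self hP0]
  rw [scaledGain, scaling_parent x y u hlP hl, scaling_child x y u hl hC,
    scaling_complement x y u hCP hl hC hD, hweight, impurityGain, sub_sub]
  rfl

lemma mem_scaledDomain_scaling (hCP : C ⊆ P) (hlP : l ⊆ P) (hl : 0 < count x l)
    (hC : 0 < count x C) (hD : 0 < count x (P \ C)) :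
    (u, orthProp x y l P, orthProp x y l C) ∈ scaledDomain (scaling x l P C) ↔
      shiftedProp x y l u P ∈ Set.Ioo (0 : ℝ) 1 ∧ shiftedProp x y l u C ∈ Set.Ioo (0 : ℝ) 1 ∧
        shiftedProp x y l u (P \ C) ∈ Set.Ioo (0 : ℝ) 1 := by
  rw [scaledDomain, Set.mem_ofPred_eq, scaling_parent x y u hlP hl, scaling_child x y u hl hC,
    scaling_complement x y u hCP hl hC hD]

end Sample

/-! ### Splits along the path -/

lemma exists_modulus_of_continuousOn_Ioo {I : ℝ → ℝ} (hI : ContinuousOn I (Set.Ioo 0 1)) {a : ℝ}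
    (ha : 0 < a) {τ : ℝ} (hτ : 0 < τ) : ∃ ρ > 0, ∀ p ∈ Set.Icc a (1 - a), ∀ r, |r - p| ≤ ρ →
      r ∈ Set.Ioo (0 : ℝ) 1 ∧ |I r - I p| ≤ τ := by
  have hsub : Set.Icc (a / 2) (1 - a / 2) ⊆ Set.Ioo (0 : ℝ) 1 :=
    Set.Icc_subset_Ioo (by linarith) (by linarith)
  obtain ⟨δ, hδ, h⟩ := Metric.uniformContinuousOn_iff_le.1
    (isCompact_Icc.uniformContinuousOn_of_continuous (hI.mono hsub)) τ hτ
  refine ⟨min (a / 2) δ, by positivity, fun p hp r hr => ?_⟩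
  have hra := abs_le.1 (hr.trans (min_le_left _ _))
  have hr' : r ∈ Set.Icc (a / 2) (1 - a / 2) := ⟨by linarith [hp.1], by linarith [hp.2]⟩
  have hp' : p ∈ Set.Icc (a / 2) (1 - a / 2) := ⟨by linarith [hp.1], by linarith [hp.2]⟩
  exact ⟨hsub hr', h r hr' p hp' (hr.trans (min_le_right _ _))⟩

namespace TreeFit

variable {𝒳 : Type*} (t : TreeFit 𝒳) {n : ℕ}

lemma leaf_subset_node (h : Fin (t.d + 1)) : t.leaf 0 ⊆ t.node h := by
  induction h using Fin.reverseInduction with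
  | last => rw [t.node_last]
  | cast h ih =>
    rw [← t.cand_zero] at ih
    exact ih.trans (t.cand_subset h 0)

/-- The regions whose proportions enter the information gains along the path. -/
def regions : Set (Set 𝒳) :=
  {R | R = t.leaf 0 ∨ ∃ h j, R = t.node h.castSucc ∨ R = t.cand h j ∨
    R = t.node h.castSucc \ t.cand h j}

lemma leaf_mem_regions : t.leaf 0 ∈ t.regions := Or.inl rfl

lemma node_mem_regions (h : Fin t.d) : t.node h.castSucc ∈ t.regions :=
  Or.inr ⟨h, 0, Or.inl rfl⟩

lemma cand_mem_regions (h : Fin t.d) (j : Fin (t.k h + 1)) : t.cand h j ∈ t.regions :=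
  Or.inr ⟨h, j, Or.inr (Or.inl rfl)⟩

lemma node_diff_cand_mem_regions (h : Fin t.d) (j : Fin (t.k h + 1)) :
    t.node h.castSucc \ t.cand h j ∈ t.regions :=
  Or.inr ⟨h, j, Or.inr (Or.inr rfl)⟩

lemma finite_regions : t.regions.Finite := by
  have hunion : t.regions = {t.leaf 0} ∪ (Set.range (fun i : t.Idx => t.node i.1.castSucc) ∪
      (Set.range (fun i : t.Idx => t.cand i.1 i.2) ∪
        Set.range (fun i : t.Idx => t.node i.1.castSucc \ t.cand i.1 i.2))) := by
    ext R
    simp only [regions, Set.mem_ofPred_eq, Set.mem_union, Set.mem_singleton_iff, Set.mem_range,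
      Sigma.exists, exists_or, eq_comm]
  rw [hunion]
  exact (Set.finite_singleton _).union ((Set.finite_range _).union
    ((Set.finite_range _).union (Set.finite_range _)))

lemma restStat_zero (x : Fin n → 𝒳) (y : Fin n → Bool) (h : Fin t.d) :
    t.restStat x y ⟨h, 0⟩ = orthProp x y (t.leaf 0) (t.node h.castSucc) := by
  simp [restStat]

lemma childEntry_restStat (x : Fin n → 𝒳) (y : Fin n → Bool) (h : Fin t.d)
    (j : Fin (t.k h + 1)) :
    t.childEntry (t.restStat x y) h j = orthProp x y (t.leaf 0) (t.cand h j) := by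
  unfold childEntry
  split_ifs with hj hd
  · subst hj
    rw [restStat_zero, t.cand_zero]
    rfl
  · subst hj
    have hlast : h.succ = Fin.last t.d := by
      ext
      simp only [Fin.val_succ, Fin.val_last]
      omega
    rw [t.cand_zero, hlast, t.node_last, orthProp_self]
  · simp [restStat, hj]

/-- The probability that the exponential mechanisms select the observed splits, as a function of the
proportions `r` of the regions. -/
def selProb (I : ℝ → ℝ) (ε : Fin t.d → ℝ) (x : Fin n → 𝒳) (r : Set 𝒳 → ℝ) : ℝ :=
  ∏ h, softmax
    (fun j => ε h * impurityGain x (fun R => I (r R)) (t.node h.castSucc) (t.cand h j)) 0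

lemma prod_splitProb (I : ℝ → ℝ) (ε : Fin t.d → ℝ) (x : Fin n → 𝒳) (y : Fin n → Bool) :
    ∏ h, splitProb I (ε h) x y (t.node h.castSucc) (t.cand h) 0 =
      t.selProb I ε x (prop x y) := rfl

lemma selProb_pos (I : ℝ → ℝ) (ε : Fin t.d → ℝ) (x : Fin n → 𝒳) (r : Set 𝒳 → ℝ) :
    0 < t.selProb I ε x r := Finset.prod_pos fun _ _ => softmax_pos _ _

lemma selProb_le_one (I : ℝ → ℝ) (ε : Fin t.d → ℝ) (x : Fin n → 𝒳) (r : Set 𝒳 → ℝ) :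
    t.selProb I ε x r ≤ 1 := Finset.prod_le_one (fun _ _ => (softmax_pos _ _).le)
  fun _ _ => softmax_le_one _ _

lemma lam_nonneg (I : ℝ → ℝ) (ε : Fin t.d → ℝ) (x : Fin n → 𝒳) (h : Fin t.d) (u : ℝ)
    (v : t.Idx → ℝ) : 0 ≤ t.lam I ε x h u v := by
  rw [lam]; split_ifs <;> positivity

lemma lam_le_one (I : ℝ → ℝ) (ε : Fin t.d → ℝ) (x : Fin n → 𝒳) (h : Fin t.d) (u : ℝ)
    (v : t.Idx → ℝ) : t.lam I ε x h u v ≤ 1 := by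
  rw [lam]
  split_ifs
  · exact softmax_le_one (fun j => ε h * t.gainFn I x h j u v) 0
  · exact zero_le_one

lemma prod_lam_nonneg (I : ℝ → ℝ) (ε : Fin t.d → ℝ) (x : Fin n → 𝒳) (u : ℝ) (v : t.Idx → ℝ) :
    0 ≤ ∏ h, t.lam I ε x h u v :=
  Finset.prod_nonneg fun h _ => t.lam_nonneg I ε x h u v

lemma prod_lam_le_one (I : ℝ → ℝ) (ε : Fin t.d → ℝ) (x : Fin n → 𝒳) (u : ℝ) (v : t.Idx → ℝ) :
    ∏ h, t.lam I ε x h u v ≤ 1 :=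
  Finset.prod_le_one (fun h _ => t.lam_nonneg I ε x h u v) fun h _ => t.lam_le_one I ε x h u v

variable {t}

lemma gainFn_restStat (I : ℝ → ℝ) {x : Fin n → 𝒳} (hx : ∀ R ∈ t.regions, 0 < count x R)
    (y : Fin n → Bool) (h : Fin t.d) (j : Fin (t.k h + 1)) (u : ℝ) :
    t.gainFn I x h j u (t.restStat x y) =
      impurityGain x (fun R => I (shiftedProp x y (t.leaf 0) u R)) (t.node h.castSucc)
        (t.cand h j) := by
  rw [gainFn, childEntry_restStat, restStat_zero, eta]
  exact scaledGain_scaling x y u I (t.cand_subset h j) (t.leaf_subset_node _)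
    (hx _ t.leaf_mem_regions) (hx _ (t.cand_mem_regions h j))
    (hx _ (t.node_diff_cand_mem_regions h j))

lemma mem_domain_restStat {x : Fin n → 𝒳} (hx : ∀ R ∈ t.regions, 0 < count x R)
    (y : Fin n → Bool) {u : ℝ}
    (hu : ∀ R ∈ t.regions, shiftedProp x y (t.leaf 0) u R ∈ Set.Ioo (0 : ℝ) 1) :
    (u, t.restStat x y) ∈ t.domain x := by
  intro h j
  dsimp only
  rw [childEntry_restStat, restStat_zero, eta,
    mem_scaledDomain_scaling x y u (t.cand_subset h j) (t.leaf_subset_node _)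
      (hx _ t.leaf_mem_regions) (hx _ (t.cand_mem_regions h j))
      (hx _ (t.node_diff_cand_mem_regions h j))]
  exact ⟨hu _ (t.node_mem_regions h), hu _ (t.cand_mem_regions h j),
    hu _ (t.node_diff_cand_mem_regions h j)⟩

lemma prod_lam_restStat (I : ℝ → ℝ) (ε : Fin t.d → ℝ) {x : Fin n → 𝒳}
    (hx : ∀ R ∈ t.regions, 0 < count x R) (y : Fin n → Bool) {u : ℝ}
    (hu : ∀ R ∈ t.regions, shiftedProp x y (t.leaf 0) u R ∈ Set.Ioo (0 : ℝ) 1) :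
    ∏ h, t.lam I ε x h u (t.restStat x y) =
      t.selProb I ε x (shiftedProp x y (t.leaf 0) u) := by
  refine Finset.prod_congr rfl fun h _ => ?_
  rw [lam, if_pos (mem_domain_restStat hx y hu)]
  simp only [gainFn_restStat I hx, softmax]

lemma exists_pos_le_selProb {I : ℝ → ℝ} (hI : ContinuousOn I (Set.Ioo 0 1)) (ε : Fin t.d → ℝ)
    {a : ℝ} (ha : 0 < a) : ∃ c > 0, ∀ (n : ℕ) (x : Fin n → 𝒳) (r : Set 𝒳 → ℝ),
      (∀ R ∈ t.regions, r R ∈ Set.Icc a (1 - a)) → c ≤ t.selProb I ε x r := by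
  have hsub : Set.Icc a (1 - a) ⊆ Set.Ioo 0 1 := Set.Icc_subset_Ioo ha (by linarith)
  obtain ⟨B, hB⟩ := isCompact_Icc.exists_bound_of_continuousOn (hI.mono hsub)
  refine ⟨∏ h, Real.exp (-(2 * (|ε h| * (2 * B)))) / Fintype.card (Fin (t.k h + 1)),
    Finset.prod_pos fun h _ => div_pos (Real.exp_pos _) (by positivity), fun n x r hr => ?_⟩
  refine Finset.prod_le_prod (fun h _ => by positivity) fun h _ =>
    exp_neg_div_card_le_softmax (fun j => ?_) 0
  rw [abs_mul]
  gcongr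
  exact abs_impurityGain_le x (t.cand_subset h j) (hB _ (hr _ (t.node_mem_regions h)))
    (hB _ (hr _ (t.cand_mem_regions h j))) (hB _ (hr _ (t.node_diff_cand_mem_regions h j)))

lemma abs_selProb_sub_le {I : ℝ → ℝ} (ε : Fin t.d → ℝ) (x : Fin n → 𝒳) {r r' : Set 𝒳 → ℝ} {τ : ℝ}
    (hr : ∀ R ∈ t.regions, |I (r R) - I (r' R)| ≤ τ) :
    |t.selProb I ε x r - t.selProb I ε x r'| ≤ Real.exp (2 * ∑ h, |ε h| * (2 * τ)) - 1 := by
  refine abs_prod_softmax_sub_le (fun h j => ?_) fun _ => 0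
  rw [← mul_sub, abs_mul, impurityGain_sub]
  gcongr
  exact abs_impurityGain_le x (t.cand_subset h j) (hr _ (t.node_mem_regions h))
    (hr _ (t.cand_mem_regions h j)) (hr _ (t.node_diff_cand_mem_regions h j))

lemma exists_abs_selProb_sub_le {I : ℝ → ℝ} (hI : ContinuousOn I (Set.Ioo 0 1))
    (ε : Fin t.d → ℝ) {a : ℝ} (ha : 0 < a) {η : ℝ} (hη : 0 < η) :
    ∃ ρ > 0, ∀ (n : ℕ) (x : Fin n → 𝒳) (r r' : Set 𝒳 → ℝ),
      (∀ R ∈ t.regions, r' R ∈ Set.Icc a (1 - a)) → (∀ R ∈ t.regions, |r R - r' R| ≤ ρ) →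
      (∀ R ∈ t.regions, r R ∈ Set.Ioo (0 : ℝ) 1) ∧
        |t.selProb I ε x r - t.selProb I ε x r'| ≤ η := by
  have hlim : Tendsto (fun τ : ℝ => Real.exp (2 * ∑ h, |ε h| * (2 * τ)) - 1) (𝓝[>] 0) (𝓝 0) :=
    tendsto_nhdsWithin_of_tendsto_nhds
      (Continuous.tendsto' (by fun_prop) 0 0 (by simp))
  obtain ⟨τ, hτη, hτ⟩ := ((hlim.eventually (gt_mem_nhds hη)).and self_mem_nhdsWithin).exists
  obtain ⟨ρ, hρ, h⟩ := exists_modulus_of_continuousOn_Ioo hI ha hτ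
  exact ⟨ρ, hρ, fun n x r r' hr' hr => ⟨fun R hR => (h _ (hr' R hR) _ (hr R hR)).1,
    (abs_selProb_sub_le ε x fun R hR => (h _ (hr' R hR) _ (hr R hR)).2).trans hτη.le⟩⟩

end TreeFit

/-! ### The outcomes -/

namespace TreeFit

variable {𝒳 : Type*} {t : TreeFit 𝒳} {n : ℕ} {x : Fin n → 𝒳} {π : Fin (t.m + 1) → ℝ}

lemma theta_eq (π : Fin (t.m + 1) → ℝ) {i : Fin n} {j : Fin (t.m + 1)} (hj : x i ∈ t.leaf j) :
    t.theta x π i = π j := by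
  rw [theta, Finset.sum_eq_single j]
  · simp [hj]
  · intro j' _ hne
    have hj' : x i ∉ t.leaf j' := fun h => Set.disjoint_left.1 (t.leaf_disjoint hne) h hj
    simp [hj']
  · simp

lemma theta_mem {A : Set ℝ} (hπ : ∀ j, π j ∈ A) (i : Fin n) : t.theta x π i ∈ A := by
  obtain ⟨j, hj⟩ := Set.mem_iUnion.1 (t.leaf_cover ▸ Set.mem_univ (x i))
  exact theta_eq π hj ▸ hπ j

lemma avg_theta_leaf_zero (π : Fin (t.m + 1) → ℝ) (hl : 0 < count x (t.leaf 0)) :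
    avg x (t.theta x π) (t.leaf 0) = π 0 := by
  classical
  have hsum : ∑ i, t.theta x π i * (if x i ∈ t.leaf 0 then 1 else 0) =
      count x (t.leaf 0) * π 0 := by
    rw [← sum_ite_mem, Finset.sum_mul]
    refine Finset.sum_congr rfl fun i _ => ?_
    by_cases hi : x i ∈ t.leaf 0
    · rw [theta_eq π hi, mul_comm]
    · simp [hi]
  rw [← count_mul_avg] at hsum
  exact mul_left_cancel₀ (by exact_mod_cast hl.ne') hsum

namespace IsModel

variable {Ω : Type*} [MeasurableSpace Ω] {P : Measure Ω} {I : ℝ → ℝ} {ε : Fin t.d → ℝ}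
  {Y : Fin n → Ω → Bool} {S : (h : Fin t.d) → Ω → Fin (t.k h + 1)}

lemma theta_mem_Icc (hM : t.IsModel P I ε x π Y S) (i : Fin n) :
    t.theta x π i ∈ Set.Icc 0 1 :=
  Set.Ioo_subset_Icc_self (theta_mem hM.param_mem i)

lemma measurable_outcomes (hM : t.IsModel P I ε x π Y S) : Measurable fun ω i => Y i ω :=
  measurable_pi_lambda _ hM.measurable_Y

lemma measurable_comp (hM : t.IsModel P I ε x π Y S) {β : Type*} [MeasurableSpace β]
    (g : (Fin n → Bool) → β) : Measurable fun ω => g fun i => Y i ω :=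
  (measurable_of_finite g).comp hM.measurable_outcomes

lemma integrable_comp (hM : t.IsModel P I ε x π Y S) (g : (Fin n → Bool) → ℝ) :
    Integrable (fun ω => g fun i => Y i ω) P := by
  have := hM.isProb
  have hg : Integrable g (P.map fun ω i => Y i ω) := .of_finite
  exact hg.comp_measurable hM.measurable_outcomes

lemma integral_comp (hM : t.IsModel P I ε x π Y S) (F : Bool → ℝ) (i : Fin n) :
    ∫ ω, F (Y i ω) ∂P = t.theta x π i * F true + (1 - t.theta x π i) * F false := by
  have := hM.isProb
  have hY := hM.measurable_Y i
  have := Measure.isProbabilityMeasure_map (μ := P) hY.aemeasurable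
  have htrue : (P.map (Y i)).real {true} = t.theta x π i := by
    rw [map_measureReal_apply hY (measurableSet_singleton _), ← hM.bernoulli i]
    rfl
  have hfalse : (P.map (Y i)).real {false} = 1 - t.theta x π i := by
    rw [← htrue, ← probReal_compl_eq_one_sub (measurableSet_singleton _)]
    congr 1
    ext b
    cases b <;> simp
  rw [← integral_map (f := F) hY.aemeasurable
    (StronglyMeasurable.of_discrete (f := F)).aestronglyMeasurable, integral_fintype .of_finite,
    Fintype.sum_bool, htrue, hfalse, smul_eq_mul, smul_eq_mul]

lemma measurable_residual (hM : t.IsModel P I ε x π Y S) (R : Set 𝒳) (i : Fin n) :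
    Measurable fun ω => residual x (t.theta x π) R i (Y i ω) :=
  (measurable_of_finite (residual x (t.theta x π) R i)).comp (hM.measurable_Y i)

lemma memLp_residual (hM : t.IsModel P I ε x π Y S) (R : Set 𝒳) (i : Fin n) :
    MemLp (fun ω => residual x (t.theta x π) R i (Y i ω)) 2 P := by
  have := hM.isProb
  exact .of_bound (hM.measurable_residual R i).aestronglyMeasurable 1
    (ae_of_all _ fun ω => abs_residual_le_one x (hM.theta_mem_Icc i) R _)

lemma integral_residual (hM : t.IsModel P I ε x π Y S) (R : Set 𝒳) (i : Fin n) :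
    ∫ ω, residual x (t.theta x π) R i (Y i ω) ∂P = 0 := by
  rw [hM.integral_comp]
  simp only [residual, Bool.toNat_true, Bool.toNat_false, Nat.cast_one, Nat.cast_zero]
  ring

lemma iIndepFun_residual (hM : t.IsModel P I ε x π Y S) (R : Set 𝒳) :
    iIndepFun (fun i ω => residual x (t.theta x π) R i (Y i ω)) P :=
  hM.indep.comp (residual x (t.theta x π) R) fun _ => measurable_of_finite _

open Classical in
lemma variance_residual (hM : t.IsModel P I ε x π Y S) (R : Set 𝒳) (i : Fin n) :
    Var[fun ω => residual x (t.theta x π) R i (Y i ω); P] =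
      t.theta x π i * (1 - t.theta x π i) * (if x i ∈ R then 1 else 0) := by
  rw [variance_of_integral_eq_zero (hM.measurable_residual R i).aemeasurable
    (hM.integral_residual R i), hM.integral_comp (fun b => residual x (t.theta x π) R i b ^ 2)]
  simp only [residual, Bool.toNat_true, Bool.toNat_false, Nat.cast_one, Nat.cast_zero]
  split_ifs <;> ring

lemma sum_variance_residual_le (hM : t.IsModel P I ε x π Y S) (R : Set 𝒳) :
    ∑ i, Var[fun ω => residual x (t.theta x π) R i (Y i ω); P] ≤ count x R := by
  classical
  rw [← sum_ite_mem]
  refine Finset.sum_le_sum fun i _ => ?_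
  obtain ⟨h0, h1⟩ := hM.theta_mem_Icc i
  rw [hM.variance_residual R i]
  exact mul_le_of_le_one_left (by positivity) (by nlinarith)

lemma sum_variance_residual_leaf_zero (hM : t.IsModel P I ε x π Y S) :
    ∑ i, Var[fun ω => residual x (t.theta x π) (t.leaf 0) i (Y i ω); P] =
      count x (t.leaf 0) * (π 0 * (1 - π 0)) := by
  classical
  rw [← sum_ite_mem, Finset.sum_mul]
  refine Finset.sum_congr rfl fun i _ => ?_
  rw [hM.variance_residual]
  by_cases hi : x i ∈ t.leaf 0
  · rw [theta_eq π hi, mul_comm]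
  · simp [hi]

lemma measure_lt_abs_prop_sub_avg_le (hM : t.IsModel P I ε x π Y S) {R : Set 𝒳}
    (hR : 0 < count x R) {δ : ℝ} (hδ : 0 < δ) :
    P {ω | δ < |prop x (fun i => Y i ω) R - avg x (t.theta x π) R|} ≤
      ENNReal.ofReal (1 / (count x R * δ ^ 2)) := by
  have := hM.isProb
  have hR0 : (0 : ℝ) < count x R := by exact_mod_cast hR
  set Z : Fin n → Ω → ℝ := fun i ω => residual x (t.theta x π) R i (Y i ω)
  have hvar : Var[∑ i, Z i; P] ≤ count x R := by
    rw [IndepFun.variance_sum (fun i _ => hM.memLp_residual R i) fun i _ j _ hij =>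
      (hM.iIndepFun_residual R).indepFun hij]
    exact hM.sum_variance_residual_le R
  have hmean : ∫ ω, (∑ i, Z i) ω ∂P = 0 := by
    simp only [Finset.sum_apply]
    rw [integral_finsetSum _ fun i _ => (hM.memLp_residual R i).integrable one_le_two]
    exact Finset.sum_eq_zero fun i _ => hM.integral_residual R i
  have hcheb := meas_ge_le_variance_div_sq
    (memLp_finsetSum' Finset.univ fun i _ => hM.memLp_residual R i) (mul_pos hR0 hδ)
  rw [hmean] at hcheb
  refine ((measure_mono fun ω hω => ?_).trans hcheb).trans (ENNReal.ofReal_le_ofReal ?_)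
  · simp only [Set.mem_ofPred_eq, Finset.sum_apply, sub_zero] at hω ⊢
    rw [sum_residual, abs_mul, Nat.abs_cast]
    gcongr
  · calc Var[∑ i, Z i; P] / (count x R * δ) ^ 2 ≤ count x R / (count x R * δ) ^ 2 := by gcongr
      _ = 1 / (count x R * δ ^ 2) := by field_simp

lemma measure_lt_abs_mainStat_sub_le (hM : t.IsModel P I ε x π Y S)
    (hl : 0 < count x (t.leaf 0)) {L : ℝ} (hL : 0 < L) :
    P {ω | L < |t.mainStat x (fun i => Y i ω) - √(count x (t.leaf 0)) * π 0|} ≤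
      ENNReal.ofReal (1 / L ^ 2) := by
  have hl0 : (0 : ℝ) < count x (t.leaf 0) := by exact_mod_cast hl
  have hsqrt : 0 < √(count x (t.leaf 0) : ℝ) := Real.sqrt_pos.2 hl0
  have h := hM.measure_lt_abs_prop_sub_avg_le hl (div_pos hL hsqrt)
  rw [avg_theta_leaf_zero π hl, div_pow, Real.sq_sqrt hl0.le, mul_div_cancel₀ _ hl0.ne'] at h
  convert h using 4 with ω
  rw [mainStat, ← mul_sub, abs_mul, abs_of_pos hsqrt, div_lt_iff₀ hsqrt, mul_comm]

/-! ### The selection event -/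

lemma measurableSet_observed (hM : t.IsModel P I ε x π Y S) : MeasurableSet (t.observed S) := by
  rw [observed, Set.ofPred_forall]
  exact .iInter fun h => hM.measurable_S h (measurableSet_singleton _)

lemma setIntegral_observed (hM : t.IsModel P I ε x π Y S) (g : (Fin n → Bool) → ℝ) :
    ∫ ω in t.observed S, g (fun i => Y i ω) ∂P =
      ∫ ω, t.selProb I ε x (prop x fun i => Y i ω) * g (fun i => Y i ω) ∂P := by
  have := hM.isProb
  have hY := hM.measurable_outcomes
  have hg : ∀ f : (Fin n → Bool) → ℝ, StronglyMeasurable f := fun f => .of_discrete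
  rw [← integral_map (f := g) hY.aemeasurable (hg g).aestronglyMeasurable,
    ← integral_map (f := fun y => t.selProb I ε x (prop x y) * g y) hY.aemeasurable
      (hg _).aestronglyMeasurable, integral_fintype .of_finite, integral_fintype .of_finite]
  refine Finset.sum_congr rfl fun y _ => ?_
  have hy := measurableSet_singleton y
  rw [smul_eq_mul, smul_eq_mul, ← mul_assoc, map_measureReal_apply hY hy,
    map_measureReal_apply hY hy, measureReal_restrict_apply (hY hy)]
  congr 1
  have hmech := hM.mechanism y fun _ => 0
  rw [prod_splitProb] at hmech
  convert hmech using 2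
  · ext ω; simp [observed, funext_iff]
  · congr 1; ext ω; simp [funext_iff]

lemma measureReal_observed (hM : t.IsModel P I ε x π Y S) :
    P.real (t.observed S) = ∫ ω, t.selProb I ε x (prop x fun i => Y i ω) ∂P := by
  simpa using hM.setIntegral_observed fun _ => 1

lemma isProbabilityMeasure_cond (hM : t.IsModel P I ε x π Y S) :
    IsProbabilityMeasure P[|t.observed S] := by
  have := hM.isProb
  have hpos := fun ω => t.selProb_pos I ε x (prop x fun i => Y i ω)
  have hsupp : (Function.support fun ω => t.selProb I ε x (prop x fun i => Y i ω)) = Set.univ :=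
    Set.eq_univ_of_forall fun ω => (hpos ω).ne'
  have hobs : 0 < P.real (t.observed S) := by
    rw [hM.measureReal_observed, integral_pos_iff_support_of_nonneg (fun ω => (hpos ω).le)
      (hM.integrable_comp fun y => t.selProb I ε x (prop x y)), hsupp]
    simp
  exact cond_isProbabilityMeasure (ENNReal.toReal_pos_iff.1 hobs).1.ne'

end IsModel

end TreeFit

/-! ### The pivot -/

lemma abs_setIntegral_div_integral_sub_le {α : Type*} [MeasurableSpace α] {μ : Measure α}
    [IsProbabilityMeasure μ] {Λ : α → ℝ} (hΛ : Integrable Λ μ) {A : Set α} (hA : MeasurableSet A)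
    {c e : ℝ} (hc : 0 < c) (hΛc : ∫ x, |Λ x - c| ∂μ ≤ e) (hec : 2 * e ≤ c) :
    |(∫ x in A, Λ x ∂μ) / ∫ x, Λ x ∂μ - μ.real A| ≤ 4 * e / c := by
  have hmean : |∫ x, Λ x ∂μ - c| ≤ e := by
    refine le_trans ?_ hΛc
    simpa [integral_sub hΛ (integrable_const c)] using
      abs_integral_le_integral_abs (μ := μ) (f := fun x => Λ x - c)
  have hhalf : c / 2 ≤ ∫ x, Λ x ∂μ := by linarith [(abs_le.1 hmean).1]
  have hpos : 0 < ∫ x, Λ x ∂μ := (half_pos hc).trans_le hhalf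
  have h := norm_inv_integral_smul_sub_integral_le hΛ hpos
    (g := A.indicator fun _ => (1 : ℝ)) (C := 1)
    (aestronglyMeasurable_const.indicator hA) (fun x => by
      by_cases hx : x ∈ A <;> simp [hx]) c
  simp only [smul_eq_mul, ← Set.indicator_mul_right, mul_one, integral_indicator hA,
    setIntegral_const, Real.norm_eq_abs, inv_mul_eq_div] at h
  calc _ ≤ 2 * (∫ x, |Λ x - c| ∂μ) / ∫ x, Λ x ∂μ := h
    _ ≤ 2 * e / (c / 2) := by
        have : 0 ≤ e := (integral_nonneg fun _ => abs_nonneg _).trans hΛc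
        gcongr
    _ = 4 * e / c := by ring

lemma measureReal_gaussianReal_lt_abs_sub_le (m : ℝ) (v : ℝ≥0) {L : ℝ} (hL : 0 < L) :
    (gaussianReal m v).real {u | L < |u - m|} ≤ v / L ^ 2 := by
  have h := meas_ge_le_variance_div_sq (memLp_id_gaussianReal (μ := m) (v := v) 2) hL
  simp only [variance_id_gaussianReal, integral_id_gaussianReal, id_eq] at h
  exact ENNReal.toReal_le_of_le_ofReal (by positivity)
    ((measure_mono fun u (hu : L < |u - m|) => hu.le).trans h)

/-- The weight `Λ` is only controlled on a window around `m`; Chebyshev bounds the rest. -/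
lemma integral_abs_sub_gaussianReal_le (m : ℝ) (v : ℝ≥0) {Λ : ℝ → ℝ} (hΛ : Measurable Λ)
    (hΛ01 : ∀ u, Λ u ∈ Set.Icc 0 1) {c : ℝ} (hc : c ∈ Set.Icc 0 1) {L b : ℝ} (hL : 0 < L)
    (hΛc : ∀ u, |u - m| ≤ L → |Λ u - c| ≤ b) :
    ∫ u, |Λ u - c| ∂gaussianReal m v ≤ b + v / L ^ 2 := by
  have hle : ∀ u, |Λ u - c| ≤ 1 := fun u =>
    abs_sub_le_iff.2 ⟨by linarith [(hΛ01 u).2, hc.1], by linarith [(hΛ01 u).1, hc.2]⟩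
  have hb : 0 ≤ b := (abs_nonneg _).trans (hΛc m (by simpa using hL.le))
  have hm : Measurable fun u => |Λ u - c| := by fun_prop
  refine (integral_le_add_mul_measureReal (A := {u | L < |u - m|})
    (.of_bound hm.aestronglyMeasurable 1 (ae_of_all _ fun u => by simpa using hle u))
    (measurableSet_lt measurable_const (by fun_prop)).nullMeasurableSet
    (fun u hu => hΛc u (not_lt.1 hu)) fun u _ => (hle u).trans (le_add_of_nonneg_left hb)).trans ?_
  rw [one_mul]
  gcongr
  exact measureReal_gaussianReal_lt_abs_sub_le m v hL

lemma measurableSet_scaledDomain (η : Fin 8 → ℝ) : MeasurableSet (scaledDomain η) := by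
  unfold scaledDomain
  refine .inter ?_ (.inter ?_ ?_) <;> exact measurableSet_Ioo.preimage (by fun_prop)

namespace TreeFit

variable {𝒳 : Type*} (t : TreeFit 𝒳) {n : ℕ}

lemma measurableSet_domain_section (x : Fin n → 𝒳) (v : t.Idx → ℝ) :
    MeasurableSet {u | (u, v) ∈ t.domain x} := by
  have hinter : {u | (u, v) ∈ t.domain x} = ⋂ h, ⋂ j,
      (fun u : ℝ => (u, v ⟨h, 0⟩, t.childEntry v h j)) ⁻¹' scaledDomain (t.eta x h j) := by
    ext; simp [domain]
  rw [hinter]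
  exact .iInter fun h => .iInter fun j => (measurableSet_scaledDomain _).preimage (by fun_prop)

lemma continuousOn_gainFn {I : ℝ → ℝ} (hI : ContinuousOn I (Set.Ioo 0 1)) (x : Fin n → 𝒳)
    (h : Fin t.d) (j : Fin (t.k h + 1)) (v : t.Idx → ℝ) :
    ContinuousOn (fun u => t.gainFn I x h j u v) {u | (u, v) ∈ t.domain x} :=
  ((hI.comp (by fun_prop) fun _ hu => (hu h j).1).sub
    (continuousOn_const.mul (hI.comp (by fun_prop) fun _ hu => (hu h j).2.1))).sub
    (continuousOn_const.mul (hI.comp (by fun_prop) fun _ hu => (hu h j).2.2))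

lemma measurable_lam {I : ℝ → ℝ} (hI : ContinuousOn I (Set.Ioo 0 1)) (ε : Fin t.d → ℝ)
    (x : Fin n → 𝒳) (h : Fin t.d) (v : t.Idx → ℝ) : Measurable fun u => t.lam I ε x h u v := by
  classical
  have hexp : ∀ j, ContinuousOn (fun u => Real.exp (ε h * t.gainFn I x h j u v))
      {u | (u, v) ∈ t.domain x} := fun j =>
    (continuousOn_const.mul (t.continuousOn_gainFn hI x h j v)).rexp
  have hratio := (hexp 0).div (continuousOn_finsetSum Finset.univ fun j _ => hexp j)
    fun u _ => (Finset.sum_pos (fun j _ => Real.exp_pos _) Finset.univ_nonempty).ne'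
  exact hratio.measurable_piecewise continuousOn_const (t.measurableSet_domain_section x v)

lemma measurable_prod_lam {I : ℝ → ℝ} (hI : ContinuousOn I (Set.Ioo 0 1)) (ε : Fin t.d → ℝ)
    (x : Fin n → 𝒳) (v : t.Idx → ℝ) : Measurable fun u => ∏ h, t.lam I ε x h u v :=
  Finset.measurable_fun_prod _ fun h _ => t.measurable_lam hI ε x h v

lemma measurable_pivot {I : ℝ → ℝ} (hI : ContinuousOn I (Set.Ioo 0 1)) (ε : Fin t.d → ℝ)
    (x : Fin n → 𝒳) (s : ℝ) (v : t.Idx → ℝ) (mean : ℝ) : Measurable (t.pivot I ε x s v mean) := by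
  have hdensity : StronglyMeasurable fun w : ℝ × ℝ => t.pivotDensity I ε x v mean w.1 w.2 := by
    refine (Measurable.mul ?_ ((t.measurable_prod_lam hI ε x v).comp
      measurable_snd)).stronglyMeasurable
    exact measurable_uncurry_gaussianPDFReal.comp
      (f := fun w : ℝ × ℝ => (mean, w.1.toNNReal, w.2)) (by fun_prop)
  exact hdensity.integral_prod_right.measurable.div hdensity.integral_prod_right.measurable

lemma pivot_eq_gaussianReal (I : ℝ → ℝ) (ε : Fin t.d → ℝ) (x : Fin n → 𝒳) (s : ℝ)
    (v : t.Idx → ℝ) (mean : ℝ) {σ2 : ℝ} (hσ2 : 0 < σ2) :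
    t.pivot I ε x s v mean σ2 =
      (∫ u in Set.Iic s, ∏ h, t.lam I ε x h u v ∂gaussianReal mean σ2.toNNReal) /
        ∫ u, ∏ h, t.lam I ε x h u v ∂gaussianReal mean σ2.toNNReal := by
  have hv : σ2.toNNReal ≠ 0 := by simpa using hσ2
  rw [← integral_indicator measurableSet_Iic, integral_gaussianReal_eq_integral_smul hv,
    integral_gaussianReal_eq_integral_smul hv]
  simp only [pivot, pivotDensity, smul_eq_mul, ← Set.indicator_mul_right,
    integral_indicator measurableSet_Iic]

lemma abs_pivot_sub_cdf_le {I : ℝ → ℝ} (hI : ContinuousOn I (Set.Ioo 0 1)) (ε : Fin t.d → ℝ)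
    (x : Fin n → 𝒳) (s : ℝ) {v : t.Idx → ℝ} {mean σ2 c L b e : ℝ} (hσ2 : 0 < σ2)
    (hc : c ∈ Set.Ioc 0 1) (hL : 0 < L)
    (hlam : ∀ u, |u - mean| ≤ L → |∏ h, t.lam I ε x h u v - c| ≤ b)
    (he : b + σ2 / L ^ 2 ≤ e) (hec : 2 * e ≤ c) :
    |t.pivot I ε x s v mean σ2 - cdf (gaussianReal mean σ2.toNNReal) s| ≤ 4 * e / c := by
  have hΛ := t.measurable_prod_lam hI ε x v
  have hΛ01 : ∀ u, ∏ h, t.lam I ε x h u v ∈ Set.Icc 0 1 := fun u =>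
    ⟨t.prod_lam_nonneg I ε x u v, t.prod_lam_le_one I ε x u v⟩
  have hclose := integral_abs_sub_gaussianReal_le mean σ2.toNNReal hΛ hΛ01
    (Set.Ioc_subset_Icc_self hc) hL hlam
  rw [Real.coe_toNNReal _ hσ2.le] at hclose
  rw [t.pivot_eq_gaussianReal I ε x s v mean hσ2, cdf_eq_real]
  exact abs_setIntegral_div_integral_sub_le
    (.of_mem_Icc 0 1 hΛ.aemeasurable (ae_of_all _ hΛ01)) measurableSet_Iic hc.1
    (hclose.trans he) hec

lemma IsModel.measurable_pivot {t : TreeFit 𝒳} {Ω : Type*} [MeasurableSpace Ω] {P : Measure Ω}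
    {I : ℝ → ℝ} {ε : Fin t.d → ℝ} {x : Fin n → 𝒳} {π : Fin (t.m + 1) → ℝ} {Y : Fin n → Ω → Bool}
    {S : (h : Fin t.d) → Ω → Fin (t.k h + 1)} (hM : t.IsModel P I ε x π Y S)
    (hI : ContinuousOn I (Set.Ioo 0 1)) {σ2 : Ω → ℝ} (hσ2 : Measurable σ2) (mean : ℝ) :
    Measurable fun ω => t.pivot I ε x (t.mainStat x fun i => Y i ω)
      (t.restStat x fun i => Y i ω) mean (σ2 ω) := by
  have hpair {F : (Fin n → Bool) → ℝ → ℝ} (hF : ∀ y, Measurable (F y)) :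
      Measurable fun ω => F (fun i => Y i ω) (σ2 ω) :=
    (measurable_from_prod_countable_right (f := fun w => F w.1 w.2) hF).comp
      (hM.measurable_outcomes.prodMk hσ2)
  exact hpair fun y => t.measurable_pivot hI ε x (t.mainStat x y) (t.restStat x y) mean

end TreeFit

/-! ### Asymptotics -/

lemma mul_one_sub_mem_Icc {a p : ℝ} (ha : 0 ≤ a) (hp : p ∈ Set.Icc a (1 - a)) :
    p * (1 - p) ∈ Set.Icc (a ^ 2) (1 / 4) := by
  obtain ⟨h₀, h₁⟩ := hp
  constructor <;> nlinarith [sq_nonneg (p - 1 / 2)]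

lemma abs_div_sqrt_sub_div_sqrt_le (z : ℝ) {w s σ : ℝ} (hw : 0 < w) (hs : w ^ 2 ≤ s)
    (hσ : w ^ 2 ≤ σ) : |z / √s - z / √σ| ≤ |z| * |s - σ| / (2 * w ^ 3) := by
  have hws : w ≤ √s := Real.le_sqrt_of_sq_le hs
  have hwσ : w ≤ √σ := Real.le_sqrt_of_sq_le hσ
  have hs0 : 0 < √s := hw.trans_le hws
  have hσ0 : 0 < √σ := hw.trans_le hwσ
  have hconj : σ - s = (√σ - √s) * (√s + √σ) := by
    linear_combination Real.sq_sqrt ((sq_nonneg w).trans hs) -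
      Real.sq_sqrt ((sq_nonneg w).trans hσ)
  have hdiff : z / √s - z / √σ = z * (σ - s) / (√s * √σ * (√s + √σ)) := by
    rw [hconj]
    field_simp
  have hden : 2 * w ^ 3 ≤ √s * √σ * (√s + √σ) :=
    calc 2 * w ^ 3 = w * w * (w + w) := by ring
      _ ≤ √s * √σ * (√s + √σ) := by gcongr
  rw [hdiff, abs_div, abs_mul, abs_sub_comm σ s,
    abs_of_pos (by positivity : 0 < √s * √σ * (√s + √σ))]
  gcongr

lemma abs_cdf_gaussianReal_sub_le (m : ℝ) {s w s2 σ2 : ℝ} (hw : 0 < w) (hs2 : w ^ 2 ≤ s2)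
    (hσ2 : w ^ 2 ≤ σ2) :
    |cdf (gaussianReal m s2.toNNReal) s - cdf (gaussianReal 0 1) ((s - m) / √σ2)| ≤
      |s - m| * |s2 - σ2| / (2 * w ^ 3) := by
  have hs20 : 0 < s2 := (pow_pos hw 2).trans_le hs2
  rw [cdf_gaussianReal m (by simpa using hs20) s, Real.coe_toNNReal _ hs20.le]
  have hlip := lipschitzWith_cdf_gaussianReal_zero_one.dist_le_mul ((s - m) / √s2) ((s - m) / √σ2)
  simp only [NNReal.coe_one, one_mul, Real.dist_eq] at hlip
  exact hlip.trans (abs_div_sqrt_sub_div_sqrt_le _ hw hs2 hσ2)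

lemma tendsto_atTop_of_tendsto_natCast_div {f : ℕ → ℕ} {c : ℝ≥0∞} (hc : c < ∞)
    (hf : Tendsto (fun n : ℕ => (n : ℝ≥0∞) / f n) atTop (𝓝 c)) : Tendsto f atTop atTop := by
  obtain ⟨k, hk⟩ := ENNReal.exists_nat_gt hc.ne
  refine tendsto_atTop.2 fun b => ?_
  filter_upwards [hf.eventually (gt_mem_nhds hk), eventually_gt_atTop (k * b)] with n hn hbn
  have hkn := (ENNReal.div_le_iff_le_mul (.inr (ENNReal.natCast_ne_top k))
    (.inl (ENNReal.natCast_ne_top _))).1 hn.le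
  exact (Nat.lt_of_mul_lt_mul_left (hbn.trans_le (by exact_mod_cast hkn))).le

namespace TreeFit

variable {𝒳 : Type*} {t : TreeFit 𝒳}

/-- The total distance of the proportions of successes that enter the gains from their means. -/
def totalDeviation {n : ℕ} (t : TreeFit 𝒳) (x : Fin n → 𝒳) (π : Fin (t.m + 1) → ℝ)
    (y : Fin n → Bool) : ℝ :=
  ∑ R ∈ t.finite_regions.toFinset, |prop x y R - avg x (t.theta x π) R|

/-- The first key statistic, centered and scaled by its mean and standard deviation. -/
def standardized {n : ℕ} (t : TreeFit 𝒳) (x : Fin n → 𝒳) (π : Fin (t.m + 1) → ℝ)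
    (y : Fin n → Bool) : ℝ :=
  (t.mainStat x y - √(count x (t.leaf 0)) * π 0) / √(π 0 * (1 - π 0))

lemma abs_prop_sub_avg_le_totalDeviation {n : ℕ} (x : Fin n → 𝒳) (π : Fin (t.m + 1) → ℝ)
    (y : Fin n → Bool) {R : Set 𝒳} (hR : R ∈ t.regions) :
    |prop x y R - avg x (t.theta x π) R| ≤ t.totalDeviation x π y :=
  Finset.single_le_sum (f := fun R => |prop x y R - avg x (t.theta x π) R|)
    (fun _ _ => abs_nonneg _) (t.finite_regions.mem_toFinset.2 hR)

/-- At the observed statistics, `u` in place of the first one moves every proportion by at most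
`2 L / √n₁`, so that the proportions stay close to their means. -/
lemma abs_prod_lam_sub_selProb_le {n : ℕ} {I : ℝ → ℝ} {ε : Fin t.d → ℝ} {x : Fin n → 𝒳}
    {π : Fin (t.m + 1) → ℝ} {y : Fin n → Bool} {a ρ b L m u : ℝ}
    (hclose : ∀ r r' : Set 𝒳 → ℝ, (∀ R ∈ t.regions, r' R ∈ Set.Icc a (1 - a)) →
      (∀ R ∈ t.regions, |r R - r' R| ≤ ρ) → (∀ R ∈ t.regions, r R ∈ Set.Ioo (0 : ℝ) 1) ∧
        |t.selProb I ε x r - t.selProb I ε x r'| ≤ b)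
    (hx : ∀ R ∈ t.regions, 0 < count x R) (hπ : ∀ j, π j ∈ Set.Icc a (1 - a))
    (hdev : t.totalDeviation x π y ≤ ρ / 2) (hL : 2 * L / √(count x (t.leaf 0)) ≤ ρ / 2)
    (hT : |t.mainStat x y - m| ≤ L) (hu : |u - m| ≤ L) :
    |∏ h, t.lam I ε x h u (t.restStat x y) - t.selProb I ε x (avg x (t.theta x π))| ≤ b := by
  have huT : |u - √(count x (t.leaf 0)) * prop x y (t.leaf 0)| ≤ 2 * L := by
    rw [abs_sub_comm] at hT
    exact (abs_sub_le u m (t.mainStat x y)).trans (by linarith)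
  have hshift : ∀ R ∈ t.regions,
      |shiftedProp x y (t.leaf 0) u R - avg x (t.theta x π) R| ≤ ρ := fun R hR =>
    calc |shiftedProp x y (t.leaf 0) u R - avg x (t.theta x π) R|
        ≤ |shiftedProp x y (t.leaf 0) u R - prop x y R| +
            |prop x y R - avg x (t.theta x π) R| := abs_sub_le _ _ _
      _ ≤ 2 * L / √(count x (t.leaf 0)) + ρ / 2 :=
          add_le_add ((abs_shiftedProp_sub_prop_le x y (t.leaf 0) u R).trans (by gcongr))
            ((abs_prop_sub_avg_le_totalDeviation x π y hR).trans hdev)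
      _ ≤ ρ := by linarith
  obtain ⟨hIoo, hsel⟩ :=
    hclose _ _ (fun R hR => avg_mem_Icc x (theta_mem hπ) (hx R hR)) hshift
  rwa [prod_lam_restStat I ε hx y hIoo]

variable {I : ℝ → ℝ} {ε : Fin t.d → ℝ} {X : (n : ℕ) → Fin n → 𝒳}
  {π : ℕ → Fin (t.m + 1) → ℝ} {Ω : ℕ → Type*} [∀ n, MeasurableSpace (Ω n)]
  {P : ∀ n, Measure (Ω n)} {Y : ∀ n, Fin n → Ω n → Bool}
  {S : ∀ n, (h : Fin t.d) → Ω n → Fin (t.k h + 1)} {a : ℝ}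

lemma ParamsBounded.exists_mem_Icc (h : t.ParamsBounded π)
    (hπ : ∀ n j, π n j ∈ Set.Ioo (0 : ℝ) 1) :
    ∃ a > 0, ∀ᶠ n in atTop, ∀ j, π n j ∈ Set.Icc a (1 - a) := by
  have hleaf : ∀ j, ∃ a > 0, ∀ᶠ n in atTop, π n j ∈ Set.Icc a (1 - a) := by
    intro j
    obtain ⟨a, ha, haj⟩ := exists_between (h j).1
    obtain ⟨b, hbj, hb⟩ := exists_between (h j).2
    have hlow := Filter.eventually_lt_of_lt_liminf haj
      (isBoundedUnder_of ⟨0, fun n => (hπ n j).1.le⟩)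
    have hupp := Filter.eventually_lt_of_limsup_lt hbj
      (isBoundedUnder_of ⟨1, fun n => (hπ n j).2.le⟩)
    refine ⟨min a (1 - b), lt_min ha (by linarith), ?_⟩
    filter_upwards [hlow, hupp] with n hn hn'
    exact ⟨(min_le_left _ _).trans hn.le, by linarith [min_le_right a (1 - b)]⟩
  choose a ha haπ using hleaf
  obtain ⟨j₀, hj₀⟩ := Finite.exists_min a
  refine ⟨a j₀, ha j₀, (eventually_all.2 haπ).mono fun n hn j => ?_⟩
  exact Set.Icc_subset_Icc (hj₀ j) (by linarith [hj₀ j]) (hn j)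

lemma eventually_count_pos
    (hcount : ∀ R ∈ t.regions, Tendsto (fun n => count (X n) R) atTop atTop) :
    ∀ᶠ n in atTop, ∀ R ∈ t.regions, 0 < count (X n) R :=
  t.finite_regions.eventually_all.2 fun R hR => (hcount R hR).eventually_gt_atTop 0

lemma vanishesInProb_prop_sub_avg (hM : ∀ n, t.IsModel (P n) I ε (X n) (π n) (Y n) (S n))
    {R : Set 𝒳} (hR : Tendsto (fun n => count (X n) R) atTop atTop) :
    VanishesInProb P fun n ω =>
      prop (X n) (fun i => Y n i ω) R - avg (X n) (t.theta (X n) (π n)) R := by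
  intro δ hδ
  have hlim : Tendsto (fun n => 1 / ((count (X n) R : ℝ) * δ ^ 2)) atTop (𝓝 0) :=
    ((tendsto_natCast_atTop_atTop.comp hR).atTop_mul_const (by positivity)).const_div_atTop 1
  refine tendsto_of_tendsto_of_tendsto_of_le_of_le' tendsto_const_nhds
    (by simpa only [ENNReal.ofReal_zero] using ENNReal.tendsto_ofReal hlim)
    (.of_forall fun _ => zero_le) ?_
  filter_upwards [hR.eventually_gt_atTop 0] with n hn
  exact (hM n).measure_lt_abs_prop_sub_avg_le hn hδ

lemma vanishesInProb_totalDeviation (hM : ∀ n, t.IsModel (P n) I ε (X n) (π n) (Y n) (S n))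
    (hcount : ∀ R ∈ t.regions, Tendsto (fun n => count (X n) R) atTop atTop) :
    VanishesInProb P fun n ω => t.totalDeviation (X n) (π n) fun i => Y n i ω :=
  .finset_sum fun R hR =>
    (vanishesInProb_prop_sub_avg hM (hcount R (t.finite_regions.mem_toFinset.1 hR))).abs

lemma tendsto_integral_abs_selProb_sub (hM : ∀ n, t.IsModel (P n) I ε (X n) (π n) (Y n) (S n))
    (hI : ContinuousOn I (Set.Ioo 0 1))
    (hcount : ∀ R ∈ t.regions, Tendsto (fun n => count (X n) R) atTop atTop) (ha : 0 < a)
    (hπ : ∀ᶠ n in atTop, ∀ j, π n j ∈ Set.Icc a (1 - a)) :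
    Tendsto (fun n => ∫ ω, |t.selProb I ε (X n) (prop (X n) fun i => Y n i ω) -
      t.selProb I ε (X n) (avg (X n) (t.theta (X n) (π n)))| ∂P n) atTop (𝓝 0) := by
  have hprob := fun n => (hM n).isProb
  refine VanishesInProb.tendsto_integral_abs (C := 1)
    ((vanishesInProb_totalDeviation hM hcount).of_forall_le fun δ hδ p _ => ?_)
    (fun n => ((hM n).measurable_comp fun y => t.selProb I ε (X n) (prop (X n) y) - _).aemeasurable)
    fun n ω => abs_sub_le_of_nonneg_of_le (t.selProb_pos ..).le (t.selProb_le_one ..)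
      (t.selProb_pos ..).le (t.selProb_le_one ..)
  obtain ⟨ρ, hρ, hclose⟩ := exists_abs_selProb_sub_le hI ε ha hδ
  refine ⟨ρ, hρ, ?_⟩
  filter_upwards [hπ, eventually_count_pos hcount] with n hπn hn
  refine ⟨∅, by simp, fun ω _ hω => (hclose n (X n) _ _
    (fun R hR => avg_mem_Icc _ (theta_mem hπn) (hn R hR)) fun R hR => ?_).2⟩
  exact (abs_prop_sub_avg_le_totalDeviation _ _ _ hR).trans ((le_abs_self _).trans hω)

lemma exists_pos_le_measureReal_observed
    (hM : ∀ n, t.IsModel (P n) I ε (X n) (π n) (Y n) (S n)) (hI : ContinuousOn I (Set.Ioo 0 1))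
    (hcount : ∀ R ∈ t.regions, Tendsto (fun n => count (X n) R) atTop atTop) (ha : 0 < a)
    (hπ : ∀ᶠ n in atTop, ∀ j, π n j ∈ Set.Icc a (1 - a)) :
    ∃ c > 0, ∀ᶠ n in atTop, c ≤ (P n).real (t.observed (S n)) := by
  obtain ⟨c, hc, hsel⟩ := exists_pos_le_selProb hI ε ha
  refine ⟨c / 2, half_pos hc, ?_⟩
  filter_upwards [hπ, eventually_count_pos hcount,
    (tendsto_integral_abs_selProb_sub hM hI hcount ha hπ).eventually (gt_mem_nhds (half_pos hc))]
    with n hπn hn hsmall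
  have := (hM n).isProb
  have hmean := hsel n (X n) (avg (X n) (t.theta (X n) (π n))) fun R hR =>
    avg_mem_Icc (X n) (theta_mem hπn) (hn R hR)
  have habs := abs_integral_le_integral_abs (μ := P n)
    (f := fun ω => t.selProb I ε (X n) (prop (X n) fun i => Y n i ω) -
      t.selProb I ε (X n) (avg (X n) (t.theta (X n) (π n))))
  rw [integral_sub ((hM n).integrable_comp fun y => t.selProb I ε (X n) (prop (X n) y))
    (integrable_const _), integral_const, probReal_univ, one_smul,
    ← (hM n).measureReal_observed] at habs
  linarith [(abs_le.1 (habs.trans hsmall.le)).1]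

lemma IsModel.sum_residual_div_sqrt_eq_standardized {n : ℕ} {Ω : Type*} [MeasurableSpace Ω]
    {P : Measure Ω} {x : Fin n → 𝒳} {π : Fin (t.m + 1) → ℝ} {Y : Fin n → Ω → Bool}
    {S : (h : Fin t.d) → Ω → Fin (t.k h + 1)} (hM : t.IsModel P I ε x π Y S) (ω : Ω) :
    (∑ i, residual x (t.theta x π) (t.leaf 0) i (Y i ω)) /
        √(∑ i, Var[fun ω => residual x (t.theta x π) (t.leaf 0) i (Y i ω); P]) =
      t.standardized x π fun i => Y i ω := by
  rw [sum_residual x _ _ fun i => Y i ω, hM.sum_variance_residual_leaf_zero,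
    Real.sqrt_mul (Nat.cast_nonneg _), ← div_div, mul_div_right_comm, Real.div_sqrt, standardized,
    mainStat, ← mul_sub]
  rcases (count x (t.leaf 0)).eq_zero_or_pos with h | h
  · simp [h]
  · rw [avg_theta_leaf_zero π h]

lemma tendstoInDistribution_standardized (hM : ∀ n, t.IsModel (P n) I ε (X n) (π n) (Y n) (S n))
    [∀ n, IsProbabilityMeasure (P n)]
    (hcount : Tendsto (fun n => count (X n) (t.leaf 0)) atTop atTop) (ha : 0 < a)
    (hπ : ∀ᶠ n in atTop, π n 0 ∈ Set.Icc a (1 - a)) :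
    TendstoInDistribution (fun n ω => t.standardized (X n) (π n) fun i => Y n i ω) atTop id P
      (gaussianReal 0 1) := by
  simp only [← (hM _).sum_residual_div_sqrt_eq_standardized]
  refine tendstoInDistribution_sum_div_sqrt_variance
    (fun n i => ((hM n).measurable_residual _ i).aemeasurable)
    (fun n i ω => abs_residual_le_one _ ((hM n).theta_mem_Icc i) _ _)
    (fun n i => (hM n).integral_residual _ i) (fun n => (hM n).iIndepFun_residual _) ?_
  simp only [(hM _).sum_variance_residual_leaf_zero]
  refine tendsto_atTop_mono' _ ?_ ((tendsto_natCast_atTop_atTop (R := ℝ)).comp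
    hcount |>.atTop_mul_const (pow_pos ha 2))
  filter_upwards [hπ] with n hn
  exact mul_le_mul_of_nonneg_left (mul_one_sub_mem_Icc ha.le hn).1 (Nat.cast_nonneg _)

lemma tendstoInDistribution_standardized_cond
    (hM : ∀ n, t.IsModel (P n) I ε (X n) (π n) (Y n) (S n)) [∀ n, IsProbabilityMeasure (P n)]
    [∀ n, IsProbabilityMeasure (P n)[|t.observed (S n)]] (hI : ContinuousOn I (Set.Ioo 0 1))
    (hcount : ∀ R ∈ t.regions, Tendsto (fun n => count (X n) R) atTop atTop) (ha : 0 < a)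
    (hπ : ∀ᶠ n in atTop, ∀ j, π n j ∈ Set.Icc a (1 - a)) :
    TendstoInDistribution (fun n ω => t.standardized (X n) (π n) fun i => Y n i ω) atTop id
      (fun n => (P n)[|t.observed (S n)]) (gaussianReal 0 1) := by
  obtain ⟨c, hc, hobs⟩ := exists_pos_le_measureReal_observed hM hI hcount ha hπ
  exact tendstoInDistribution_cond
    (tendstoInDistribution_standardized hM (hcount _ t.leaf_mem_regions) ha
      (hπ.mono fun n hn => hn 0)) hc hobs
    (fun n => (hM n).integrable_comp fun y => t.selProb I ε (X n) (prop (X n) y))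
    (fun n F => (hM n).setIntegral_observed fun y => F (t.standardized (X n) (π n) y))
    (tendsto_integral_abs_selProb_sub hM hI hcount ha hπ)

lemma eventually_measure_lt_abs_mainStat_sub_le
    (hM : ∀ n, t.IsModel (P n) I ε (X n) (π n) (Y n) (S n))
    (hcount : Tendsto (fun n => count (X n) (t.leaf 0)) atTop atTop) {p : ℝ≥0∞} (hp : 0 < p) :
    ∀ᶠ L : ℝ in atTop, ∀ᶠ n in atTop, P n {ω | L < |t.mainStat (X n) (fun i => Y n i ω) -
      √(count (X n) (t.leaf 0)) * π n 0|} ≤ p := by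
  have hlim : Tendsto (fun L : ℝ => ENNReal.ofReal (1 / L ^ 2)) atTop (𝓝 0) := by
    simpa only [ENNReal.ofReal_zero] using ENNReal.tendsto_ofReal
      ((tendsto_pow_atTop two_ne_zero).const_div_atTop 1)
  filter_upwards [hlim.eventually (ge_mem_nhds hp), eventually_gt_atTop 0] with L hLp hL
  filter_upwards [hcount.eventually_gt_atTop 0] with n hn
  exact ((hM n).measure_lt_abs_mainStat_sub_le hn hL).trans hLp

lemma tendsto_two_mul_div_sqrt_count {R : Set 𝒳}
    (hR : Tendsto (fun n => count (X n) R) atTop atTop) (L : ℝ) :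
    Tendsto (fun n => 2 * L / √(count (X n) R)) atTop (𝓝 0) :=
  (Real.tendsto_sqrt_atTop.comp (tendsto_natCast_atTop_atTop.comp hR)).const_div_atTop _

lemma abs_pivot_restStat_sub_cdf_le {n : ℕ} {x : Fin n → 𝒳} {π : Fin (t.m + 1) → ℝ}
    {y : Fin n → Bool} {ρ q L m c σ2 : ℝ} (s : ℝ) (hI : ContinuousOn I (Set.Ioo 0 1))
    (hclose : ∀ r r' : Set 𝒳 → ℝ, (∀ R ∈ t.regions, r' R ∈ Set.Icc a (1 - a)) →
      (∀ R ∈ t.regions, |r R - r' R| ≤ ρ) → (∀ R ∈ t.regions, r R ∈ Set.Ioo (0 : ℝ) 1) ∧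
        |t.selProb I ε x r - t.selProb I ε x r'| ≤ q)
    (hx : ∀ R ∈ t.regions, 0 < count x R) (hπ : ∀ j, π j ∈ Set.Icc a (1 - a))
    (hdev : t.totalDeviation x π y ≤ ρ / 2) (hLρ : 2 * L / √(count x (t.leaf 0)) ≤ ρ / 2)
    (hT : |t.mainStat x y - m| ≤ L) (hL : 0 < L) (hLq : 1 / L ^ 2 ≤ q)
    (hσ2 : σ2 ∈ Set.Ioc 0 1) (hc : 0 < c) (hsel : c ≤ t.selProb I ε x (avg x (t.theta x π)))
    (hqc : 4 * q ≤ c) :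
    |t.pivot I ε x s (t.restStat x y) m σ2 - cdf (gaussianReal m σ2.toNNReal) s| ≤ 8 * q / c := by
  have hq : 0 ≤ q := (by positivity : 0 ≤ 1 / L ^ 2).trans hLq
  have htail : σ2 / L ^ 2 ≤ q := (div_le_div_of_nonneg_right hσ2.2 (by positivity)).trans hLq
  calc |t.pivot I ε x s (t.restStat x y) m σ2 - cdf (gaussianReal m σ2.toNNReal) s|
      ≤ 4 * (2 * q) / t.selProb I ε x (avg x (t.theta x π)) :=
        t.abs_pivot_sub_cdf_le hI ε x s hσ2.1 ⟨t.selProb_pos .., t.selProb_le_one ..⟩ hL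
          (fun _ hu => abs_prod_lam_sub_selProb_le hclose hx hπ hdev hLρ hT hu)
          (by linarith) (by linarith)
    _ ≤ 8 * q / c := by rw [← mul_assoc]; norm_num; gcongr

lemma vanishesInProb_pivot_sub_cdf
    (hM : ∀ n, t.IsModel (P n) I ε (X n) (π n) (Y n) (S n)) (hI : ContinuousOn I (Set.Ioo 0 1))
    (hcount : ∀ R ∈ t.regions, Tendsto (fun n => count (X n) R) atTop atTop) (ha : 0 < a)
    (hπ : ∀ᶠ n in atTop, ∀ j, π n j ∈ Set.Icc a (1 - a)) {σ2hat : ∀ n, Ω n → ℝ}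
    (hσ : VanishesInProb P fun n ω => σ2hat n ω - π n 0 * (1 - π n 0)) :
    VanishesInProb P fun n ω =>
      t.pivot I ε (X n) (t.mainStat (X n) fun i => Y n i ω) (t.restStat (X n) fun i => Y n i ω)
          (√(count (X n) (t.leaf 0)) * π n 0) (σ2hat n ω) -
        cdf (gaussianReal (√(count (X n) (t.leaf 0)) * π n 0) (σ2hat n ω).toNNReal)
          (t.mainStat (X n) fun i => Y n i ω) := by
  refine ((vanishesInProb_totalDeviation hM hcount).abs.add hσ.abs).of_forall_le
    fun δ hδ p hp => ?_
  obtain ⟨c, hc, hsel⟩ := exists_pos_le_selProb hI ε ha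
  obtain ⟨q, hq, hqc, hqδ⟩ : ∃ q > 0, 4 * q ≤ c ∧ 8 * q ≤ c * δ :=
    ⟨min (c / 4) (c * δ / 8), by positivity, by linarith [min_le_left (c / 4) (c * δ / 8)],
      by linarith [min_le_right (c / 4) (c * δ / 8)]⟩
  have hleaf := hcount _ t.leaf_mem_regions
  have hsq : Tendsto (fun L : ℝ => 1 / L ^ 2) atTop (𝓝 0) :=
    (tendsto_pow_atTop two_ne_zero).const_div_atTop 1
  obtain ⟨L, htight, hLq, hL⟩ := ((eventually_measure_lt_abs_mainStat_sub_le hM hleaf hp).and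
    ((hsq.eventually (ge_mem_nhds hq)).and (eventually_gt_atTop 0))).exists
  obtain ⟨ρ, hρ, hclose⟩ := exists_abs_selProb_sub_le hI ε ha hq
  refine ⟨min (ρ / 2) (a ^ 2 / 2), by positivity, ?_⟩
  filter_upwards [hπ, eventually_count_pos hcount, htight,
    (tendsto_two_mul_div_sqrt_count hleaf L).eventually (ge_mem_nhds (half_pos hρ))]
    with n hπn hn htightn hLn
  refine ⟨_, htightn, fun ω hT hω => ?_⟩
  rw [abs_of_nonneg (by positivity), le_min_iff] at hω
  have hdev := (le_abs_self _).trans ((le_add_of_nonneg_right (abs_nonneg _)).trans hω.1)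
  have hσω := abs_le.1 ((le_add_of_nonneg_left (abs_nonneg _)).trans hω.2)
  obtain ⟨hvar, hvar'⟩ := mul_one_sub_mem_Icc ha.le (hπn 0)
  refine (abs_pivot_restStat_sub_cdf_le _ hI (hclose n (X n)) hn hπn hdev hLn (not_lt.1 hT) hL hLq
    ⟨by linarith [pow_pos ha 2], by linarith⟩ hc
    (hsel n (X n) _ fun R hR => avg_mem_Icc (X n) (theta_mem hπn) (hn R hR)) hqc).trans ?_
  rw [div_le_iff₀ hc]
  linarith

lemma vanishesInProb_cdf_sub_cdf_standardized
    (hM : ∀ n, t.IsModel (P n) I ε (X n) (π n) (Y n) (S n))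
    (hcount : Tendsto (fun n => count (X n) (t.leaf 0)) atTop atTop) (ha : 0 < a)
    (hπ : ∀ᶠ n in atTop, π n 0 ∈ Set.Icc a (1 - a)) {σ2hat : ∀ n, Ω n → ℝ}
    (hσ : VanishesInProb P fun n ω => σ2hat n ω - π n 0 * (1 - π n 0)) :
    VanishesInProb P fun n ω =>
      cdf (gaussianReal (√(count (X n) (t.leaf 0)) * π n 0) (σ2hat n ω).toNNReal)
          (t.mainStat (X n) fun i => Y n i ω) -
        cdf (gaussianReal 0 1) (t.standardized (X n) (π n) fun i => Y n i ω) := by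
  refine hσ.of_forall_le fun δ hδ p hp => ?_
  obtain ⟨L, htight, hL⟩ := ((eventually_measure_lt_abs_mainStat_sub_le hM hcount hp).and
    (eventually_gt_atTop 0)).exists
  refine ⟨min (a ^ 2 / 2) (2 * (a / 2) ^ 3 * δ / L), by positivity, ?_⟩
  filter_upwards [hπ, htight] with n hπn htightn
  refine ⟨_, htightn, fun ω hT hω => ?_⟩
  rw [le_min_iff] at hω
  have hvar := (mul_one_sub_mem_Icc ha.le hπn).1
  have hw : (a / 2) ^ 2 ≤ a ^ 2 / 2 := by linarith [div_pow a 2 2, sq_nonneg a]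
  refine (abs_cdf_gaussianReal_sub_le _ (half_pos ha)
    (by linarith [(abs_le.1 hω.1).1]) (by linarith [sq_nonneg a])).trans ?_
  rw [div_le_iff₀ (by positivity)]
  calc _ ≤ L * (2 * (a / 2) ^ 3 * δ / L) := by gcongr; exacts [not_lt.1 hT, hω.2]
    _ = δ * (2 * (a / 2) ^ 3) := by field_simp

lemma vanishesInProb_pivot_sub_cdf_standardized
    (hM : ∀ n, t.IsModel (P n) I ε (X n) (π n) (Y n) (S n)) (hI : ContinuousOn I (Set.Ioo 0 1))
    (hcount : ∀ R ∈ t.regions, Tendsto (fun n => count (X n) R) atTop atTop) (ha : 0 < a)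
    (hπ : ∀ᶠ n in atTop, ∀ j, π n j ∈ Set.Icc a (1 - a)) {σ2hat : ∀ n, Ω n → ℝ}
    (hσ : VanishesInProb P fun n ω => σ2hat n ω - π n 0 * (1 - π n 0)) :
    VanishesInProb P fun n ω =>
      t.pivot I ε (X n) (t.mainStat (X n) fun i => Y n i ω) (t.restStat (X n) fun i => Y n i ω)
          (√(count (X n) (t.leaf 0)) * π n 0) (σ2hat n ω) -
        cdf (gaussianReal 0 1) (t.standardized (X n) (π n) fun i => Y n i ω) := by
  simpa only [sub_add_sub_cancel] using (vanishesInProb_pivot_sub_cdf hM hI hcount ha hπ hσ).add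
    (vanishesInProb_cdf_sub_cdf_standardized hM (hcount _ t.leaf_mem_regions) ha
      (hπ.mono fun n hn => hn 0) hσ)

lemma ProportionalGrowth.tendsto_count (hX : t.ProportionalGrowth X) {R : Set 𝒳}
    (hR : R ∈ t.regions) : Tendsto (fun n => count (X n) R) atTop atTop := by
  have hlarge : ∀ R : Set 𝒳,
      (R = t.leaf 0 ∨ ∃ h j, R = t.cand h j ∨ R = t.node h.castSucc \ t.cand h j) →
        Tendsto (fun n => count (X n) R) atTop atTop := fun R hR =>
    let ⟨_, hc, hlim⟩ := hX R hR
    tendsto_atTop_of_tendsto_natCast_div hc hlim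
  rcases hR with rfl | ⟨h, j, rfl | hR⟩
  · exact hlarge _ (Or.inl rfl)
  · exact tendsto_atTop_mono (fun n => count_mono (X n) (t.leaf_subset_node _))
      (hlarge _ (Or.inl rfl))
  · exact hlarge _ (Or.inr ⟨h, j, hR⟩)

end TreeFit

lemma SmoothInformation.continuousOn {I : ℝ → ℝ} (hI : SmoothInformation I) :
    ContinuousOn I (Set.Ioo 0 1) := by
  simpa only [iteratedDeriv_zero] using (hI.1 0 (by norm_num)).continuousOn

end

end TreeInference

open TreeInference in
theorem theorem3_general {𝒳 : Type*} (t : TreeFit 𝒳) (I : ℝ → ℝ) (ε : Fin t.d → ℝ)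
    (X : (n : ℕ) → Fin n → 𝒳) (π : ℕ → Fin (t.m + 1) → ℝ)
    {Ω : ℕ → Type*} [∀ n, MeasurableSpace (Ω n)] (P : ∀ n, Measure (Ω n))
    (Y : ∀ n, Fin n → Ω n → Bool) (S : ∀ n, (h : Fin t.d) → Ω n → Fin (t.k h + 1))
    (hmodel : ∀ n, t.IsModel (P n) I ε (X n) (π n) (Y n) (S n))
    (hcount : ∀ R ∈ t.regions, Tendsto (fun n => count (X n) R) atTop atTop)
    (hparams : t.ParamsBounded π)
    (hI : ContinuousOn I (Set.Ioo 0 1))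
    (σ2hat : ∀ n, Ω n → ℝ) (hσ_meas : ∀ n, Measurable (σ2hat n))
    (hσ : ∀ δ : ℝ, 0 < δ → Tendsto
      (fun n => P n {ω | δ < |σ2hat n ω - π n 0 * (1 - π n 0)|}) atTop (𝓝 0)) :
    (∀ δ : ℝ, 0 < δ → Tendsto
      (fun n => (P n)[{ω | δ < |σ2hat n ω - π n 0 * (1 - π n 0)|} | t.observed (S n)])
        atTop (𝓝 0)) ∧
    ∃ _ : ∀ n, IsProbabilityMeasure (P n)[|t.observed (S n)],
      TendstoInDistribution
        (fun n ω => t.pivot I ε (X n)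
          (t.mainStat (X n) fun i => Y n i ω) (t.restStat (X n) fun i => Y n i ω)
          (√(count (X n) (t.leaf 0)) * π n 0) (σ2hat n ω))
        atTop (fun u : unitInterval => (u : ℝ))
        (fun n => (P n)[|t.observed (S n)]) volume := by
  have hprob := fun n => (hmodel n).isProb
  have hcond := fun n => (hmodel n).isProbabilityMeasure_cond
  obtain ⟨a, ha, hπ⟩ := hparams.exists_mem_Icc fun n => (hmodel n).param_mem
  obtain ⟨c, hc, hobs⟩ := TreeFit.exists_pos_le_measureReal_observed hmodel hI hcount ha hπ
  have hvanish {W : ∀ n, Ω n → ℝ} (hW : VanishesInProb P W) :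
      VanishesInProb (fun n => (P n)[|t.observed (S n)]) W :=
    hW.cond (fun n => (hmodel n).measurableSet_observed) hc hobs
  have hcontinuous : Continuous (cdf (gaussianReal 0 1)) :=
    lipschitzWith_cdf_gaussianReal_zero_one.continuous
  have hclt := (TreeFit.tendstoInDistribution_standardized_cond hmodel hI hcount ha
    hπ).continuous_comp hcontinuous
  have hpivot := TreeFit.vanishesInProb_pivot_sub_cdf_standardized hmodel hI hcount ha hπ hσ
  exact ⟨hvanish hσ, hcond, tendstoInDistribution_congr_limit
    (tendstoInDistribution_of_vanishesInProb_sub hclt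
      (fun n => ((hmodel n).measurable_pivot hI (hσ_meas n) _).aemeasurable) (hvanish hpivot))
    (identDistrib_cdf_coe_unitInterval hcontinuous)⟩

theorem theorem3 {𝒳 : Type*} (t : TreeInference.TreeFit 𝒳) (I : ℝ → ℝ) (ε : Fin t.d → ℝ)
    (X : (n : ℕ) → Fin n → 𝒳) (π : ℕ → Fin (t.m + 1) → ℝ)
    {Ω : ℕ → Type*} [∀ n, MeasurableSpace (Ω n)] (P : ∀ n, Measure (Ω n))
    (Y : ∀ n, Fin n → Ω n → Bool) (S : ∀ n, (h : Fin t.d) → Ω n → Fin (t.k h + 1))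
    (hmodel : ∀ n, t.IsModel (P n) I ε (X n) (π n) (Y n) (S n))
    (hgrowth : t.ProportionalGrowth X)
    (hparams : t.ParamsBounded π)
    (hcov : t.CovNondegenerate P X Y)
    (hI : TreeInference.SmoothInformation I)
    (σ2hat : ∀ n, Ω n → ℝ) (hσ_meas : ∀ n, Measurable (σ2hat n))
    (hσ : ∀ δ : ℝ, 0 < δ → Tendsto
      (fun n => P n {ω | δ < |σ2hat n ω - π n 0 * (1 - π n 0)|}) atTop (𝓝 0)) :
    (∀ δ : ℝ, 0 < δ → Tendsto
      (fun n => (P n)[{ω | δ < |σ2hat n ω - π n 0 * (1 - π n 0)|} | t.observed (S n)])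
        atTop (𝓝 0)) ∧
    ∃ _ : ∀ n, IsProbabilityMeasure (P n)[|t.observed (S n)],
      TendstoInDistribution
        (fun n ω => t.pivot I ε (X n)
          (t.mainStat (X n) fun i => Y n i ω) (t.restStat (X n) fun i => Y n i ω)
          (√(TreeInference.count (X n) (t.leaf 0)) * π n 0) (σ2hat n ω))
        atTop (fun u : unitInterval => (u : ℝ))
        (fun n => (P n)[|t.observed (S n)]) volume :=
  theorem3_general t I ε X π P Y S hmodel (fun _ => hgrowth.tendsto_count) hparams
    hI.continuousOn σ2hat hσ_meas hσ
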